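/- Let $\alpha\in\{0,-1,1\}$ and let $(x_*,t_*)\in\mathbb R\times(\mathbb R\setminus\{0\})$. Then there exists $u_0\in C^\infty(\mathbb R)\cap L^2(\mathbb R)\cap L^\infty(\mathbb R)$, complex valued, such that the initial-value problem $$ i\,\partial_t u-\alpha\,\partial_x^2u+\partial_x^4u=0,\qquad u|_{t=0}=u_0, $$ has a unique solution $u\in C_{\rm b}(\mathbb R;L^2(\mathbb R))$ (the equation being understood in the sense of tempered distributions in $x$ at every time $t\in\mathbb R$), and $u$ is represented by a function $u(x,t)$ on $\mathbb R\times\mathbb R$ (that is, $u(\cdot,t)$ is in the given $L^2$ class for every $t$) with the following properties: 1. $u$ blows up at $(x_*,t_*)$: $\displaystyle\lim_{(x,t)\to(x_*,t_*),\ (x,t)\ne(x_*,t_*)}|u(x,t)|=+\infty$, the limit being taken in $\mathbb R^2$; 2. $u$ is a continuous function of $(x,t)$ on $\mathbb R\times(\mathbb R\setminus\{t_*\})$; 3. $u(\cdot,t_*)$ is a continuous function on $\mathbb R\setminus\{x_*\}$. -/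

import Mathlib

open MeasureTheory Filter
open scoped Topology ContDiff BoundedContinuousFunction SchwartzMap

/-- The complex Hilbert space `L²(ℝ)` with respect to Lebesgue measure. -/
abbrev L2R : Type := Lp ℂ 2 (volume : Measure ℝ)

/-- `U ∈ C_b(ℝ; L²(ℝ))` is a solution of the initial-value problem
`i u_t - α u_xx + u_xxxx = 0`, `u(·, 0) = u₀`. The equation is required, at every time `t`,
in the sense of tempered distributions on `ℝ`: for every Schwartz function `φ`, the pairing
`t ↦ ∫ U(t) φ dx` is differentiable and
`i (d/dt) ∫ U(t) φ dx - α ∫ U(t) φ'' dx + ∫ U(t) φ'''' dx = 0`. -/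
structure IsFourthOrderSolution (α : ℝ) (u₀ : ℝ → ℂ) (U : ℝ →ᵇ L2R) : Prop where
  initial : (U 0 : ℝ → ℂ) =ᵐ[volume] u₀
  differentiable : ∀ φ : 𝓢(ℝ, ℂ), Differentiable ℝ fun t : ℝ => ∫ x : ℝ, U t x * φ x
  equation : ∀ (φ : 𝓢(ℝ, ℂ)) (t : ℝ),
    Complex.I * deriv (fun s : ℝ => ∫ x : ℝ, U s x * φ x) t
      - (α : ℂ) * (∫ x : ℝ, U t x * iteratedDeriv 2 (fun y => φ y) x)
      + (∫ x : ℝ, U t x * iteratedDeriv 4 (fun y => φ y) x) = 0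

open scoped FourierTransform

/-! On the Fourier side the equation multiplies each frequency `w` by `exp (i t (w⁴ + α w²))`.
Choose the spectrum `1 / w` on `w > 1`: it is square integrable, but its integral diverges
logarithmically. With phases centred at the prescribed point, the solution is `u(x,t) = ∫_1^∞ exp (i
((x - x₀) w + (t - t₀)(w⁴ + α w²))) / w dw`. At `(x₀, t₀)` there is no oscillation and the integral
diverges; elsewhere oscillation makes it converge.

Blow-up: put `τ = t - t₀`, replace `x - x₀` by `x`, and let `M` solve `max (|x| M) (|τ| M⁴) = 1`. On
`[1, M]` the phase is too small to oscillate, and the integral is `log M + O(1)`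
(`norm_oscIntegral_sub_log_le`). Beyond `M` it is `O(1)`: the first derivative test handles `|φ'| ≥
l`, and the remaining stationary zone has bounded length for `dw / w`
(`norm_oscIntegral_le_of_time`, `norm_oscIntegral_le_of_space`). Thus `|u| ≥ log M - 25`, and `M →
∞` at the point.

Regularity: tails `O(1 / A)` give locally uniform convergence, hence continuity. For `τ > 0`, moving
the contour to `Im z = 1` makes the integrand decay exponentially, so `u(·, t)` is smooth
(`oscLimit_eq_shift`); conjugation covers `τ < 0`.

Uniqueness: for a test function `ψ`, the pairing of the Fourier transform of a solution with the
evolved `ψ` is constant in time, which determines the solution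
(`fourier_eq_phaseMul_of_isFourthOrderSolution`). -/

/-! ### Oscillatory integrals with amplitude `1 / w` -/

/-- First derivative test: if `|φ'| ≥ l` on `[A, B]` and `φ'' ≥ 0`, the oscillatory integral of
`exp (i φ(w)) / w` over `[A, B]` is at most `5 / (l A)`. -/
theorem norm_integral_exp_div_le_of_le_abs_deriv {φ φ₁ φ₂ : ℝ → ℝ} {A B l : ℝ}
    (h₁ : ∀ w, HasDerivAt φ (φ₁ w) w) (h₂ : ∀ w, HasDerivAt φ₁ (φ₂ w) w) (hc : Continuous φ₂)
    (hA : 0 < A) (hAB : A ≤ B) (hl : 0 < l)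
    (hlow : ∀ w ∈ Set.Icc A B, l ≤ |φ₁ w|) (hconv : ∀ w ∈ Set.Icc A B, 0 ≤ φ₂ w) :
    ‖∫ w in A..B, Complex.exp (Complex.I * (φ w : ℂ)) * ((w⁻¹ : ℝ) : ℂ)‖ ≤ 5 / (l * A) := by
  have hcφ : Continuous φ := continuous_iff_continuousAt.2 fun w => (h₁ w).continuousAt
  have hcφ₁ : Continuous φ₁ := continuous_iff_continuousAt.2 fun w => (h₂ w).continuousAt
  have hne : ∀ w ∈ Set.Icc A B, φ₁ w ≠ 0 := fun w hw h0 => by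
    have := hlow w hw
    rw [h0, abs_zero] at this
    linarith
  have hpos : ∀ w ∈ Set.Icc A B, 0 < w := fun w hw => hA.trans_le hw.1
  set q : ℝ → ℝ := fun w => (φ₁ w * w)⁻¹ with hq
  set q' : ℝ → ℝ := fun w => -(φ₂ w * w + φ₁ w * 1) / (φ₁ w * w) ^ 2 with hq'
  set Φ : ℝ → ℂ := fun w => Complex.exp (Complex.I * (φ w : ℂ)) with hΦ
  have hcΦ : Continuous Φ := by fun_prop
  have hnΦ : ∀ w, ‖Φ w‖ = 1 := fun w => by
    rw [hΦ]; simp only; rw [mul_comm, Complex.norm_exp_ofReal_mul_I]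
  have hdq : ∀ w ∈ Set.Icc A B, HasDerivAt q (q' w) w := fun w hw =>
    ((h₂ w).mul (hasDerivAt_id w)).inv (mul_ne_zero (hne w hw) (hpos w hw).ne')
  have hcq' : ContinuousOn q' (Set.Icc A B) := by
    apply ContinuousOn.div
    · fun_prop
    · fun_prop
    · exact fun w hw => pow_ne_zero _ (mul_ne_zero (hne w hw) (hpos w hw).ne')
  -- Integration by parts: `G = exp (i φ) / (i φ₁ w)`, whose derivative is the integrand up to the
  -- term with `q'`.
  set G : ℝ → ℂ := fun w => -Complex.I * (Φ w * (q w : ℂ)) with hG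
  have hdΦ : ∀ w, HasDerivAt Φ (Φ w * (Complex.I * (φ₁ w : ℂ))) w := fun w =>
    ((h₁ w).ofReal_comp.const_mul Complex.I).cexp
  have hdG : ∀ w ∈ Set.Icc A B,
      HasDerivAt G (Φ w * ((w⁻¹ : ℝ) : ℂ) - Complex.I * (Φ w * (q' w : ℂ))) w := fun w hw => by
    have h := ((hdΦ w).mul (hdq w hw).ofReal_comp).const_mul (-Complex.I)
    refine h.congr_deriv ?_
    have h1 : (φ₁ w : ℂ) ≠ 0 := by exact_mod_cast hne w hw
    have h2 : (w : ℂ) ≠ 0 := by exact_mod_cast (hpos w hw).ne'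
    simp only [hq]
    push_cast
    field_simp
    ring_nf
    simp only [Complex.I_sq]
    ring
  have hc1 : ContinuousOn (fun w => Φ w * ((w⁻¹ : ℝ) : ℂ)) (Set.Icc A B) := by
    apply hcΦ.continuousOn.mul
    exact Complex.continuous_ofReal.comp_continuousOn
      (continuousOn_inv₀.mono fun w hw => (hpos w hw).ne')
  have hc2 : ContinuousOn (fun w => Complex.I * (Φ w * (q' w : ℂ))) (Set.Icc A B) :=
    continuousOn_const.mul (hcΦ.continuousOn.mul (Complex.continuous_ofReal.comp_continuousOn hcq'))
  have hu : Set.uIcc A B = Set.Icc A B := Set.uIcc_of_le hAB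
  have hi1 := (hu.symm ▸ hc1).intervalIntegrable (μ := volume)
  have hi2 := (hu.symm ▸ hc2).intervalIntegrable (μ := volume)
  have hFTC := intervalIntegral.integral_eq_sub_of_hasDerivAt
    (fun w hw => hdG w (hu ▸ hw)) (hi1.sub hi2)
  rw [intervalIntegral.integral_sub hi1 hi2] at hFTC
  -- `k'` dominates `|q'|`: use `w⁻¹ ≤ A⁻¹` in one term and `|φ₁|⁻¹ ≤ l⁻¹` in the other. Convexity
  -- makes `φ₂ / φ₁²` a nonnegative exact derivative, so the remainder costs `k B - k A ≤ 3 / (l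
  -- A)`; the two boundary terms bring the total to 5.
  set k : ℝ → ℝ := fun w => -(A⁻¹ * (φ₁ w)⁻¹) - l⁻¹ * w⁻¹ with hk
  set k' : ℝ → ℝ := fun w => -(A⁻¹ * (-φ₂ w / φ₁ w ^ 2)) - l⁻¹ * (-1 / w ^ 2) with hk'
  have hdk : ∀ w ∈ Set.Icc A B, HasDerivAt k (k' w) w := fun w hw =>
    (((h₂ w).inv (hne w hw)).const_mul A⁻¹).neg.sub
      (((hasDerivAt_id w).inv (hpos w hw).ne').const_mul l⁻¹)
  have hck' : ContinuousOn k' (Set.Icc A B) := by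
    have e1 : ContinuousOn (fun w => -φ₂ w / φ₁ w ^ 2) (Set.Icc A B) :=
      ContinuousOn.div (by fun_prop) (by fun_prop) fun w hw => pow_ne_zero _ (hne w hw)
    have e2 : ContinuousOn (fun w : ℝ => -1 / w ^ 2) (Set.Icc A B) :=
      ContinuousOn.div (by fun_prop) (by fun_prop) fun w hw => pow_ne_zero _ (hpos w hw).ne'
    exact (continuousOn_const.mul e1).neg.sub (continuousOn_const.mul e2)
  have hik := (hu.symm ▸ hck').intervalIntegrable (μ := volume)
  have hFTCk := intervalIntegral.integral_eq_sub_of_hasDerivAt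
    (fun w hw => hdk w (hu ▸ hw)) hik
  have hbd : ‖∫ w in A..B, Complex.I * (Φ w * (q' w : ℂ))‖ ≤ ∫ w in A..B, k' w := by
    refine intervalIntegral.norm_integral_le_of_norm_le hAB (Eventually.of_forall ?_) hik
    intro w hw
    have hw' : w ∈ Set.Icc A B := Set.Ioc_subset_Icc_self hw
    rw [norm_mul, Complex.norm_I, one_mul, norm_mul, hnΦ, one_mul, Complex.norm_real,
      Real.norm_eq_abs]
    have hp := hpos w hw'
    have hf : q' w = -(φ₂ w / φ₁ w ^ 2 * w⁻¹) - (φ₁ w)⁻¹ * (1 / w ^ 2) := by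
      have := hne w hw'
      simp only [hq']
      field_simp
      ring
    have t1 : |φ₂ w / φ₁ w ^ 2 * w⁻¹| ≤ A⁻¹ * (φ₂ w / φ₁ w ^ 2) := by
      have : 0 ≤ φ₂ w / φ₁ w ^ 2 := div_nonneg (hconv w hw') (sq_nonneg _)
      rw [abs_of_nonneg (mul_nonneg this (inv_nonneg.2 hp.le)), mul_comm]
      exact mul_le_mul_of_nonneg_right (inv_anti₀ hA hw'.1) this
    have t2 : |(φ₁ w)⁻¹ * (1 / w ^ 2)| ≤ l⁻¹ * (1 / w ^ 2) := by
      rw [abs_mul, abs_inv, abs_of_nonneg (by positivity : 0 ≤ 1 / w ^ 2)]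
      exact mul_le_mul_of_nonneg_right (inv_anti₀ hl (hlow w hw')) (by positivity)
    rw [hf]
    calc |-(φ₂ w / φ₁ w ^ 2 * w⁻¹) - (φ₁ w)⁻¹ * (1 / w ^ 2)|
        ≤ |-(φ₂ w / φ₁ w ^ 2 * w⁻¹)| + |(φ₁ w)⁻¹ * (1 / w ^ 2)| := abs_sub _ _
      _ ≤ A⁻¹ * (φ₂ w / φ₁ w ^ 2) + l⁻¹ * (1 / w ^ 2) := by rw [abs_neg]; exact add_le_add t1 t2
      _ = k' w := by simp only [hk']; ring
  have hAm : A ∈ Set.Icc A B := ⟨le_rfl, hAB⟩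
  have hBm : B ∈ Set.Icc A B := ⟨hAB, le_rfl⟩
  have hinv : ∀ w ∈ Set.Icc A B, |(φ₁ w)⁻¹| ≤ l⁻¹ := fun w hw => by
    rw [abs_inv]; exact inv_anti₀ hl (hlow w hw)
  have hGn : ∀ w ∈ Set.Icc A B, ‖G w‖ ≤ l⁻¹ * A⁻¹ := fun w hw => by
    simp only [hG, hq]
    rw [norm_mul, norm_neg, Complex.norm_I, one_mul, norm_mul, hnΦ, one_mul, Complex.norm_real,
      Real.norm_eq_abs, mul_inv, abs_mul, abs_of_pos (inv_pos.2 (hpos w hw))]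
    exact mul_le_mul (hinv w hw) (inv_anti₀ hA hw.1) (inv_nonneg.2 (hpos w hw).le)
      (inv_nonneg.2 hl.le)
  have hkk : k B - k A ≤ 3 * (l⁻¹ * A⁻¹) := by
    have i1 := (abs_le.1 (hinv A hAm)).2
    have i2 := (abs_le.1 (hinv B hBm)).1
    have hAi : 0 < A⁻¹ := inv_pos.2 hA
    have hBi : 0 < l⁻¹ * B⁻¹ := mul_pos (inv_pos.2 hl) (inv_pos.2 (hA.trans_le hAB))
    simp only [hk]
    nlinarith [mul_le_mul_of_nonneg_left i1 hAi.le, mul_le_mul_of_nonneg_left i2 hAi.le]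
  have hfin : (∫ w in A..B, Φ w * ((w⁻¹ : ℝ) : ℂ))
      = G B - G A + ∫ w in A..B, Complex.I * (Φ w * (q' w : ℂ)) := by
    rw [← hFTC]; ring
  have h5 : 5 / (l * A) = l⁻¹ * A⁻¹ + l⁻¹ * A⁻¹ + 3 * (l⁻¹ * A⁻¹) := by
    field_simp; norm_num
  rw [hfin, h5]
  refine (norm_add_le _ _).trans (add_le_add ((norm_sub_le _ _).trans
    (add_le_add (hGn B hBm) (hGn A hAm))) ?_)
  exact (hbd.trans_eq hFTCk).trans hkk

/-- A cut point at level `c`, falling back on an endpoint when `f` does not cross `c`; the piece on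
that side is then degenerate. -/
theorem exists_mem_Icc_le_or_le {f : ℝ → ℝ} {A B : ℝ} (hf : Continuous f) (hAB : A ≤ B) (c : ℝ) :
    ∃ p ∈ Set.Icc A B, (p = A ∨ f p ≤ c) ∧ (p = B ∨ c ≤ f p) := by
  rcases le_total c (f A) with h | h
  · exact ⟨A, ⟨le_rfl, hAB⟩, Or.inl rfl, Or.inr h⟩
  rcases le_total (f B) c with h' | h'
  · exact ⟨B, ⟨hAB, le_rfl⟩, Or.inr h', Or.inl rfl⟩
  obtain ⟨p, hp, hpc⟩ := intermediate_value_Icc hAB hf.continuousOn ⟨h, h'⟩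
  exact ⟨p, hp, Or.inr hpc.le, Or.inr hpc.ge⟩

/-- Oscillatory integral bound: away from the stationary zone `|φ'| ≤ l` the first derivative test
applies, and the stationary zone is controlled by its logarithmic length. -/
theorem norm_integral_exp_div_le {φ φ₁ φ₂ : ℝ → ℝ} {A B l κ : ℝ}
    (h₁ : ∀ w, HasDerivAt φ (φ₁ w) w) (h₂ : ∀ w, HasDerivAt φ₁ (φ₂ w) w) (hc : Continuous φ₂)
    (hA : 0 < A) (hAB : A ≤ B) (hl : 0 < l) (hκ : 0 ≤ κ)
    (hconv : ∀ w ∈ Set.Icc A B, 0 ≤ φ₂ w)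
    (hlog : ∀ p q, A ≤ p → p ≤ q → q ≤ B → |φ₁ p| ≤ l → |φ₁ q| ≤ l → Real.log (q / p) ≤ κ) :
    ‖∫ w in A..B, Complex.exp (Complex.I * (φ w : ℂ)) * ((w⁻¹ : ℝ) : ℂ)‖
      ≤ 10 / (l * A) + κ := by
  have hcφ : Continuous φ := continuous_iff_continuousAt.2 fun w => (h₁ w).continuousAt
  have hcφ₁ : Continuous φ₁ := continuous_iff_continuousAt.2 fun w => (h₂ w).continuousAt
  have hmono : MonotoneOn φ₁ (Set.Icc A B) := by
    refine monotoneOn_of_deriv_nonneg (convex_Icc A B) hcφ₁.continuousOn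
      (fun w _ => (h₂ w).differentiableAt.differentiableWithinAt) fun w hw => ?_
    rw [(h₂ w).deriv]
    exact hconv w (interior_subset hw)
  have hint : ∀ a b, 0 < a → a ≤ b → IntervalIntegrable
      (fun w => Complex.exp (Complex.I * (φ w : ℂ)) * ((w⁻¹ : ℝ) : ℂ)) volume a b := by
    intro a b ha hab
    apply ContinuousOn.intervalIntegrable
    rw [Set.uIcc_of_le hab]
    refine ContinuousOn.mul (by fun_prop) (Complex.continuous_ofReal.comp_continuousOn
      (continuousOn_inv₀.mono fun w hw => (ha.trans_le hw.1).ne'))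
  -- Since `φ₁` is monotone, `p` and `q` separate the zones `φ₁ ≤ -l`, `|φ₁| ≤ l` and `φ₁ ≥ l`.
  obtain ⟨p, ⟨hAp, hpB⟩, hp1, hp2⟩ := exists_mem_Icc_le_or_le hcφ₁ hAB (-l)
  obtain ⟨q, ⟨hpq, hqB⟩, hq1, hq2⟩ := exists_mem_Icc_le_or_le hcφ₁ hpB l
  have hp0 := hA.trans_le hAp
  have hq0 := hp0.trans_le hpq
  have hlA : 0 < l * A := mul_pos hl hA
  rw [← intervalIntegral.integral_add_adjacent_intervals (hint A p hA hAp) (hint p B hp0 hpB),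
    ← intervalIntegral.integral_add_adjacent_intervals (hint p q hp0 hpq) (hint q B hq0 hqB)]
  have b1 : ‖∫ w in A..p, Complex.exp (Complex.I * (φ w : ℂ)) * ((w⁻¹ : ℝ) : ℂ)‖
      ≤ 5 / (l * A) := by
    rcases hp1 with rfl | hp1
    · rw [intervalIntegral.integral_same, norm_zero]; positivity
    · refine norm_integral_exp_div_le_of_le_abs_deriv h₁ h₂ hc hA hAp hl (fun w hw => ?_)
        fun w hw => hconv w ⟨hw.1, hw.2.trans hpB⟩
      have := hmono ⟨hw.1, hw.2.trans hpB⟩ ⟨hAp, hpB⟩ hw.2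
      rw [le_abs]; right; linarith
  have b3 : ‖∫ w in q..B, Complex.exp (Complex.I * (φ w : ℂ)) * ((w⁻¹ : ℝ) : ℂ)‖
      ≤ 5 / (l * A) := by
    rcases hq2 with rfl | hq2
    · rw [intervalIntegral.integral_same, norm_zero]; positivity
    · refine (norm_integral_exp_div_le_of_le_abs_deriv h₁ h₂ hc hq0 hqB hl (fun w hw => ?_)
        fun w hw => hconv w ⟨(hAp.trans hpq).trans hw.1, hw.2⟩).trans ?_
      · have := hmono ⟨hAp.trans hpq, hqB⟩ ⟨(hAp.trans hpq).trans hw.1, hw.2⟩ hw.1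
        rw [le_abs]; left; linarith
      · exact div_le_div_of_nonneg_left (by norm_num) hlA
          (mul_le_mul_of_nonneg_left (hAp.trans hpq) hl.le)
  have b2 : ‖∫ w in p..q, Complex.exp (Complex.I * (φ w : ℂ)) * ((w⁻¹ : ℝ) : ℂ)‖ ≤ κ := by
    rcases hq1 with rfl | hq1
    · rw [intervalIntegral.integral_same, norm_zero]; exact hκ
    rcases hpq.eq_or_lt with rfl | hlt
    · rw [intervalIntegral.integral_same, norm_zero]; exact hκ
    have hp2' : -l ≤ φ₁ p := hp2.resolve_left (hlt.trans_le hqB).ne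
    have hm := hmono ⟨hAp, hpB⟩ ⟨hAp.trans hpq, hqB⟩ hpq
    have hb := hlog p q hAp hpq hqB (abs_le.2 ⟨hp2', by linarith⟩) (abs_le.2 ⟨by linarith, hq1⟩)
    rw [← integral_inv_of_pos hp0 hq0] at hb
    refine (intervalIntegral.norm_integral_le_of_norm_le hpq (Eventually.of_forall fun w hw => ?_)
      (intervalIntegral.intervalIntegrable_inv (fun x hx => ?_) continuousOn_id)).trans hb
    · rw [norm_mul, mul_comm Complex.I, Complex.norm_exp_ofReal_mul_I, one_mul, Complex.norm_real,
        Real.norm_of_nonneg (inv_nonneg.2 (hp0.trans hw.1).le)]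
      exact le_rfl
    · rw [Set.uIcc_of_le hpq] at hx
      exact (hp0.trans_le hx.1).ne'
  have h10 : 10 / (l * A) + κ = 5 / (l * A) + (κ + 5 / (l * A)) := by ring
  rw [h10]
  exact (norm_add_le _ _).trans (add_le_add b1 ((norm_add_le _ _).trans (add_le_add b2 b3)))

/-- The truncated oscillatory integral `∫_A^B exp (i (x w + τ (w⁴ + α w²))) / w dw`. -/
noncomputable def oscIntegral (α A B x τ : ℝ) : ℂ :=
  ∫ w in A..B, Complex.exp (Complex.I * ((x * w + τ * (w ^ 4 + α * w ^ 2) : ℝ) : ℂ))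
    * ((w⁻¹ : ℝ) : ℂ)

/-- Conjugation reduces all bounds to `τ ≥ 0`, where the phase is convex on `w ≥ 1` because `|α| ≤
1`. -/
theorem conj_oscIntegral (α A B x τ : ℝ) :
    (starRingEnd ℂ) (oscIntegral α A B x τ) = oscIntegral α A B (-x) (-τ) := by
  rw [oscIntegral, oscIntegral, ← intervalIntegral.intervalIntegral_conj]
  congr 1
  ext w
  simp only [map_mul, Complex.conj_ofReal, ← Complex.exp_conj, Complex.conj_I]
  congr 2
  push_cast
  ring

theorem norm_oscIntegral_neg (α A B x τ : ℝ) :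
    ‖oscIntegral α A B (-x) (-τ)‖ = ‖oscIntegral α A B x τ‖ := by
  rw [← conj_oscIntegral, RCLike.norm_conj]

theorem norm_oscIntegral_le_aux {α A B x τ l κ : ℝ} (hα : |α| ≤ 1) (hA : 1 ≤ A) (hAB : A ≤ B)
    (hτ : 0 ≤ τ) (hl : 0 < l) (hκ : 0 ≤ κ)
    (hlog : ∀ p q, A ≤ p → p ≤ q → |x + τ * (4 * p ^ 3 + 2 * α * p)| ≤ l →
      |x + τ * (4 * q ^ 3 + 2 * α * q)| ≤ l → Real.log (q / p) ≤ κ) :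
    ‖oscIntegral α A B x τ‖ ≤ 10 / (l * A) + κ := by
  have hα' := abs_le.1 hα
  refine norm_integral_exp_div_le (φ := fun w => x * w + τ * (w ^ 4 + α * w ^ 2))
    (φ₁ := fun w => x + τ * (4 * w ^ 3 + 2 * α * w)) (φ₂ := fun w => τ * (12 * w ^ 2 + 2 * α))
    (fun w => ?_) (fun w => ?_) (by fun_prop) (by linarith) hAB hl hκ (fun w hw => ?_)
    fun p q h1 h2 _ h3 h4 => hlog p q h1 h2 h3 h4
  · have := ((hasDerivAt_id w).const_mul x).add (((hasDerivAt_pow 4 w).add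
      ((hasDerivAt_pow 2 w).const_mul α)).const_mul τ)
    exact this.congr_deriv (by push_cast; ring)
  · have := (((((hasDerivAt_pow 3 w).const_mul 4).add
      ((hasDerivAt_id w).const_mul (2 * α)))).const_mul τ).const_add x
    exact this.congr_deriv (by push_cast; ring)
  · have h1 : 1 ≤ w := hA.trans hw.1
    exact mul_nonneg hτ (by nlinarith)

theorem oscIntegral_sign_cases {α A B C : ℝ} {P : ℝ → ℝ → Prop}
    (h : ∀ x τ, 0 ≤ τ → P x τ → ‖oscIntegral α A B x τ‖ ≤ C)
    (hP : ∀ x τ, P x τ → P (-x) (-τ)) {x τ : ℝ} (hx : P x τ) :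
    ‖oscIntegral α A B x τ‖ ≤ C := by
  rcases le_total 0 τ with h0 | h0
  · exact h x τ h0 hx
  · rw [← norm_oscIntegral_neg]
    exact h _ _ (neg_nonneg.2 h0) (hP _ _ hx)

/-- Between `p` and `q` the phase derivative gains at least `10 |τ| p² (q - p)`, and in the
stationary zone it varies by at most `2 l`; so `log (q / p) ≤ (q - p) / p ≤ l / (5 |τ| p³)`. The
level `l` stays free: `l = 1` gives decay in `A`, `l = 1 / M` a bound at the scale `|τ| M⁴ = 1`. -/
theorem norm_oscIntegral_le_of_time {α A B l : ℝ} (hα : |α| ≤ 1) (hA : 1 ≤ A) (hAB : A ≤ B)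
    (hl : 0 < l) {x τ : ℝ} (hτ : τ ≠ 0) :
    ‖oscIntegral α A B x τ‖ ≤ 10 / (l * A) + l / (5 * |τ| * A ^ 3) := by
  have hα' := abs_le.1 hα
  have key : ∀ y s, 0 ≤ s → |s| = |τ| →
      ‖oscIntegral α A B y s‖ ≤ 10 / (l * A) + l / (5 * |τ| * A ^ 3) := by
    intro y s hs hsτ
    rw [← hsτ, abs_of_nonneg hs]
    have hs0 : 0 < s := hs.lt_of_ne' fun h => hτ (abs_eq_zero.1 (by rw [← hsτ, h, abs_zero]))
    refine norm_oscIntegral_le_aux hα hA hAB hs hl (by positivity) fun p q hp hpq h1 h2 => ?_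
    have hp1 : 1 ≤ p := hA.trans hp
    have hp0 : 0 < p := by linarith
    have hd : s * (10 * p ^ 2) * (q - p) ≤ 2 * l := by
      have e1 := (abs_le.1 h1).1
      have e2 := (abs_le.1 h2).2
      have : 10 * p ^ 2 * (q - p) ≤ (4 * q ^ 3 + 2 * α * q) - (4 * p ^ 3 + 2 * α * p) := by
        have e3 : 10 * p ^ 2 ≤ 4 * (q ^ 2 + q * p + p ^ 2) + 2 * α := by nlinarith
        nlinarith [mul_le_mul_of_nonneg_right e3 (sub_nonneg.2 hpq)]
      nlinarith [mul_le_mul_of_nonneg_left this hs]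
    have hlog := Real.log_le_sub_one_of_pos (div_pos (hp0.trans_le hpq) hp0)
    refine hlog.trans ?_
    rw [div_sub_one hp0.ne', div_le_div_iff₀ hp0 (by positivity)]
    have hA3 : A ^ 3 ≤ p ^ 3 := pow_le_pow_left₀ (by linarith) hp 3
    calc (q - p) * (5 * s * A ^ 3) ≤ (q - p) * (5 * s * p ^ 3) := by
          refine mul_le_mul_of_nonneg_left ?_ (sub_nonneg.2 hpq)
          exact mul_le_mul_of_nonneg_left hA3 (by positivity)
      _ = (s * (10 * p ^ 2) * (q - p)) / 2 * p := by ring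
      _ ≤ l * p := mul_le_mul_of_nonneg_right (by linarith) hp0.le
  exact oscIntegral_sign_cases (P := fun _ s => |s| = |τ|) key (fun _ _ h => by rwa [abs_neg]) rfl

/-- Take `l = |x| / 2` and `ψ(w) = 4 w³ + 2 α w`. In the stationary zone `|τ| ψ` lies between `|x| /
2` and `3 |x| / 2`, so `ψ` varies by a factor at most 3; as `ψ(w) / w` increases, so does `w`. The
bound is uniform in `τ`. -/
theorem norm_oscIntegral_le_of_space {α A B : ℝ} (hα : |α| ≤ 1) (hA : 1 ≤ A) (hAB : A ≤ B)
    {x τ : ℝ} (hx : x ≠ 0) :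
    ‖oscIntegral α A B x τ‖ ≤ 20 / (|x| * A) + Real.log 3 := by
  have hα' := abs_le.1 hα
  have key : ∀ y s, 0 ≤ s → |y| = |x| →
      ‖oscIntegral α A B y s‖ ≤ 20 / (|x| * A) + Real.log 3 := by
    intro y s hs hyx
    have hx0 : 0 < |x| := abs_pos.2 hx
    have h := norm_oscIntegral_le_aux (x := y) (l := |x| / 2) (κ := Real.log 3) hα hA hAB hs
      (by positivity) (Real.log_nonneg (by norm_num)) ?_
    · convert h using 2
      field_simp
      norm_num
    intro p q hp hpq h1 h2
    have hp1 : 1 ≤ p := hA.trans hp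
    have hp0 : 0 < p := by linarith
    have hq0 : 0 < q := by linarith
    refine Real.log_le_log (div_pos hq0 hp0) ?_
    rw [div_le_iff₀ hp0]
    have e1 := abs_le.1 h1
    have e2 := abs_le.1 h2
    have hψp : 0 < 4 * p ^ 3 + 2 * α * p := by nlinarith [sq_nonneg p, mul_pos hp0 hp0]
    have hn : 0 ≤ s * (4 * p ^ 3 + 2 * α * p) := mul_nonneg hs hψp.le
    have hy : y = -|x| := by
      rcases abs_cases y with h | h
      · exfalso; rw [← hyx] at e1 hx0; linarith
      · linarith
    rw [hy] at e1 e2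
    have hcmp : s * (4 * q ^ 3 + 2 * α * q) ≤ 3 * (s * (4 * p ^ 3 + 2 * α * p)) := by linarith
    have hs0 : 0 < s := hs.lt_of_ne' fun h => by rw [h] at e1; linarith
    have hcmp' : (4 * q ^ 3 + 2 * α * q) ≤ 3 * (4 * p ^ 3 + 2 * α * p) := by
      refine le_of_mul_le_mul_left ?_ hs0
      linarith
    have hr : 0 < 4 * p ^ 2 + 2 * α := by nlinarith
    have hr' : (4 * p ^ 2 + 2 * α) * q ≤ 4 * q ^ 3 + 2 * α * q := by
      nlinarith [mul_le_mul_of_nonneg_right (mul_self_le_mul_self hp0.le hpq) hq0.le]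
    refine le_of_mul_le_mul_left ?_ hr
    linarith
  exact oscIntegral_sign_cases (P := fun y _ => |y| = |x|) key (fun _ _ h => by rwa [abs_neg]) rfl

theorem norm_oscIntegral_zero_le {α A B : ℝ} (hα : |α| ≤ 1) (hA : 1 ≤ A) (hAB : A ≤ B)
    {x : ℝ} (hx : x ≠ 0) : ‖oscIntegral α A B x 0‖ ≤ 20 / (|x| * A) := by
  have hx0 : 0 < |x| := abs_pos.2 hx
  have h := norm_oscIntegral_le_aux (x := x) (l := |x| / 2) (κ := 0) hα hA hAB le_rfl
    (by positivity) le_rfl fun p q _ _ h1 _ => by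
      exfalso; rw [zero_mul, add_zero] at h1; linarith
  convert h using 1
  field_simp
  norm_num

/-! ### The improper oscillatory integral -/

theorem continuousOn_oscIntegrand (α x τ : ℝ) {a b : ℝ} (ha : 0 < a) :
    ContinuousOn (fun w : ℝ => Complex.exp (Complex.I *
      ((x * w + τ * (w ^ 4 + α * w ^ 2) : ℝ) : ℂ)) * ((w⁻¹ : ℝ) : ℂ)) (Set.Icc a b) :=
  ContinuousOn.mul (by fun_prop) (Complex.continuous_ofReal.comp_continuousOn
    (continuousOn_inv₀.mono fun _ hw => (ha.trans_le hw.1).ne'))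

theorem intervalIntegrable_oscIntegrand (α x τ : ℝ) {a b : ℝ} (ha : 0 < a) (hab : a ≤ b) :
    IntervalIntegrable (fun w : ℝ => Complex.exp (Complex.I *
      ((x * w + τ * (w ^ 4 + α * w ^ 2) : ℝ) : ℂ)) * ((w⁻¹ : ℝ) : ℂ)) volume a b := by
  apply ContinuousOn.intervalIntegrable
  rw [Set.uIcc_of_le hab]
  exact continuousOn_oscIntegrand α x τ ha

theorem oscIntegral_sub (α x τ : ℝ) {A B : ℝ} (hA : 1 ≤ A) (hAB : A ≤ B) :
    oscIntegral α 1 B x τ - oscIntegral α 1 A x τ = oscIntegral α A B x τ := by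
  rw [sub_eq_iff_eq_add', oscIntegral, oscIntegral, oscIntegral,
    intervalIntegral.integral_add_adjacent_intervals
      (intervalIntegrable_oscIntegrand α x τ one_pos hA)
      (intervalIntegrable_oscIntegrand α x τ (one_pos.trans_le hA) hAB)]

theorem continuous_oscIntegral (α : ℝ) {A B : ℝ} (hA : 0 < A) (hAB : A ≤ B) :
    Continuous fun z : ℝ × ℝ => oscIntegral α A B z.1 z.2 := by
  refine intervalIntegral.continuous_of_dominated_interval (bound := fun _ => A⁻¹)
    (fun z => ?_) (fun z => Eventually.of_forall fun w hw => ?_) (by simp)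
    (Eventually.of_forall fun w hw => by fun_prop)
  · exact (intervalIntegrable_oscIntegrand α z.1 z.2 hA hAB).def'.aestronglyMeasurable
  · rw [Set.uIoc_of_le hAB] at hw
    rw [norm_mul, mul_comm Complex.I, Complex.norm_exp_ofReal_mul_I, one_mul, Complex.norm_real,
      Real.norm_of_nonneg (inv_nonneg.2 (hA.trans hw.1).le)]
    exact inv_anti₀ hA hw.1.le

/-- The improper oscillatory integral `∫_1^∞ exp (i (x w + τ (w⁴ + α w²))) / w dw`. -/
noncomputable def oscLimit (α x τ : ℝ) : ℂ :=
  limUnder atTop fun B : ℝ => oscIntegral α 1 B x τ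

theorem tendsto_oscIntegral_of_le {α x τ C : ℝ}
    (h : ∀ A B, 1 ≤ A → A ≤ B → ‖oscIntegral α A B x τ‖ ≤ C / A) :
    Tendsto (fun B : ℝ => oscIntegral α 1 B x τ) atTop (𝓝 (oscLimit α x τ)) := by
  refine CauchySeq.tendsto_limUnder (Metric.cauchySeq_iff'.2 fun ε hε => ?_)
  have hlim : Tendsto (fun A : ℝ => C / A) atTop (𝓝 0) := tendsto_const_nhds.div_atTop tendsto_id
  obtain ⟨N, hN1, hN⟩ := ((eventually_ge_atTop (1 : ℝ)).and (hlim.eventually_lt_const hε)).exists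
  refine ⟨N, fun n hn => ?_⟩
  rw [dist_eq_norm, oscIntegral_sub α x τ hN1 hn]
  exact (h N n hN1 hn).trans_lt hN

theorem norm_oscLimit_sub_le {α x τ A K : ℝ} (hA : 1 ≤ A)
    (ht : Tendsto (fun B : ℝ => oscIntegral α 1 B x τ) atTop (𝓝 (oscLimit α x τ)))
    (h : ∀ B, A ≤ B → ‖oscIntegral α A B x τ‖ ≤ K) :
    ‖oscLimit α x τ - oscIntegral α 1 A x τ‖ ≤ K := by
  refine le_of_tendsto (ht.sub_const _).norm ?_
  filter_upwards [eventually_ge_atTop A] with B hB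
  rw [oscIntegral_sub α x τ hA hB]
  exact h B hB

/-- A uniform tail bound makes the truncations converge uniformly. The map `f` allows restriction to
the line `τ = 0`, where the decaying bound used is the one along that line. -/
theorem continuousOn_oscLimit_of_le {X : Type*} [TopologicalSpace X] {f : X → ℝ × ℝ}
    (hf : Continuous f) {S : Set X} {α C : ℝ}
    (h : ∀ z ∈ S, ∀ A B, 1 ≤ A → A ≤ B → ‖oscIntegral α A B (f z).1 (f z).2‖ ≤ C / A) :
    ContinuousOn (fun z => oscLimit α (f z).1 (f z).2) S := by
  have hlim : Tendsto (fun A : ℝ => C / A) atTop (𝓝 0) := tendsto_const_nhds.div_atTop tendsto_id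
  have hu : TendstoUniformlyOn (fun (B : ℝ) z => oscIntegral α 1 B (f z).1 (f z).2)
      (fun z => oscLimit α (f z).1 (f z).2) atTop S := by
    refine Metric.tendstoUniformlyOn_iff.2 fun ε hε => ?_
    filter_upwards [eventually_ge_atTop (1 : ℝ), hlim.eventually_lt_const hε] with A hA hAε z hz
    rw [dist_eq_norm]
    exact (norm_oscLimit_sub_le hA (tendsto_oscIntegral_of_le (h z hz))
      fun B hB => h z hz A B hA hB).trans_lt hAε
  refine hu.continuousOn (Eventually.frequently ?_)
  filter_upwards [eventually_ge_atTop (1 : ℝ)] with A hA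
  exact ((continuous_oscIntegral α one_pos hA).comp hf).continuousOn

theorem norm_oscIntegral_le_div_of_time {α A B δ : ℝ} (hα : |α| ≤ 1) (hA : 1 ≤ A) (hAB : A ≤ B)
    (hδ : 0 < δ) {x τ : ℝ} (hτ : δ ≤ |τ|) :
    ‖oscIntegral α A B x τ‖ ≤ (10 + 1 / (5 * δ)) / A := by
  have hτ0 : τ ≠ 0 := abs_pos.1 (hδ.trans_le hτ)
  have hA0 : 0 < A := one_pos.trans_le hA
  refine (norm_oscIntegral_le_of_time hα hA hAB one_pos hτ0).trans ?_
  rw [add_div, one_mul, div_div]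
  refine add_le_add le_rfl (div_le_div_of_nonneg_left zero_le_one (by positivity) ?_)
  exact mul_le_mul (by linarith) (le_self_pow₀ hA (by norm_num)) hA0.le (by positivity)

/-- Only the origin is excluded: there the truncations are `log B` and diverge. -/
theorem tendsto_oscIntegral {α x τ : ℝ} (hα : |α| ≤ 1) (h : x ≠ 0 ∨ τ ≠ 0) :
    Tendsto (fun B : ℝ => oscIntegral α 1 B x τ) atTop (𝓝 (oscLimit α x τ)) := by
  by_cases hτ : τ = 0
  · subst hτ
    have hx : x ≠ 0 := h.resolve_right (by simp)
    refine tendsto_oscIntegral_of_le (C := 20 / |x|) fun A B hA hAB => ?_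
    rw [div_div]
    exact norm_oscIntegral_zero_le hα hA hAB hx
  · exact tendsto_oscIntegral_of_le fun A B hA hAB =>
      norm_oscIntegral_le_div_of_time hα hA hAB (abs_pos.2 hτ) le_rfl

theorem norm_oscLimit_le {α x τ : ℝ} (hα : |α| ≤ 1) (hτ : τ ≠ 0) :
    ‖oscLimit α x τ‖ ≤ 10 + 1 / (5 * |τ|) := by
  have h := norm_oscLimit_sub_le le_rfl (tendsto_oscIntegral (x := x) hα (Or.inr hτ))
    fun B hB => norm_oscIntegral_le_div_of_time hα le_rfl hB (abs_pos.2 hτ) le_rfl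
  rwa [oscIntegral, intervalIntegral.integral_same, sub_zero, div_one] at h

theorem continuousAt_oscLimit {α : ℝ} (hα : |α| ≤ 1) {z : ℝ × ℝ} (hz : z.2 ≠ 0) :
    ContinuousAt (fun z : ℝ × ℝ => oscLimit α z.1 z.2) z := by
  have hδ : 0 < |z.2| / 2 := half_pos (abs_pos.2 hz)
  have hc := continuousOn_oscLimit_of_le (f := fun z : ℝ × ℝ => z) continuous_id
    (S := {y : ℝ × ℝ | |z.2| / 2 < |y.2|}) (α := α) fun y hy A B hA hAB =>
      norm_oscIntegral_le_div_of_time hα hA hAB hδ (le_of_lt hy)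
  refine hc.continuousAt (IsOpen.mem_nhds ?_ (half_lt_self (abs_pos.2 hz)))
  exact isOpen_lt continuous_const (by fun_prop)

theorem continuousAt_oscLimit_zero {α : ℝ} (hα : |α| ≤ 1) {x : ℝ} (hx : x ≠ 0) :
    ContinuousAt (fun x : ℝ => oscLimit α x 0) x := by
  have hδ : 0 < |x| / 2 := half_pos (abs_pos.2 hx)
  have hc := continuousOn_oscLimit_of_le (f := fun x : ℝ => (x, (0 : ℝ))) (by fun_prop)
    (S := {y : ℝ | |x| / 2 < |y|}) (α := α) (C := 20 / (|x| / 2)) fun y hy A B hA hAB => by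
      have hy' : |x| / 2 < |y| := hy
      refine (norm_oscIntegral_zero_le hα hA hAB (abs_pos.1 (hδ.trans hy))).trans ?_
      rw [div_div]
      exact div_le_div_of_nonneg_left (by norm_num) (by positivity)
        (mul_le_mul_of_nonneg_right hy'.le (by linarith))
  exact hc.continuousAt (IsOpen.mem_nhds (isOpen_lt continuous_const (by fun_prop))
    (half_lt_self (abs_pos.2 hx)))

/-! ### Logarithmic blow-up at the origin -/

/-- On `[1, M]` the phase is at most `3 w / M`, so replacing the exponential by 1 costs at most `3 /
M` per unit length. -/
theorem norm_oscIntegral_sub_log_le {α x τ M : ℝ} (hα : |α| ≤ 1) (hM : 1 ≤ M)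
    (hx : |x| * M ≤ 1) (hτ : |τ| * M ^ 4 ≤ 1) :
    ‖oscIntegral α 1 M x τ - (Real.log M : ℂ)‖ ≤ 3 := by
  have hM0 : 0 < M := one_pos.trans_le hM
  have hlog : (Real.log M : ℂ) = ∫ w in (1 : ℝ)..M, ((w⁻¹ : ℝ) : ℂ) := by
    rw [intervalIntegral.integral_ofReal, integral_inv_of_pos one_pos hM0, div_one]
  have hi : IntervalIntegrable (fun w : ℝ => ((w⁻¹ : ℝ) : ℂ)) volume 1 M := by
    apply ContinuousOn.intervalIntegrable
    rw [Set.uIcc_of_le hM]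
    exact Complex.continuous_ofReal.comp_continuousOn
      (continuousOn_inv₀.mono fun _ hw => (one_pos.trans_le hw.1).ne')
  rw [hlog, oscIntegral,
    ← intervalIntegral.integral_sub (intervalIntegrable_oscIntegrand α x τ one_pos hM) hi]
  refine (intervalIntegral.norm_integral_le_of_norm_le_const (C := 3 / M) fun w hw => ?_).trans ?_
  · rw [Set.uIoc_of_le hM] at hw
    have hw0 : 0 < w := one_pos.trans hw.1
    rw [← sub_one_mul, norm_mul, Complex.norm_real, Real.norm_of_nonneg (inv_nonneg.2 hw0.le),
      ← div_eq_mul_inv, div_le_div_iff₀ hw0 hM0]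
    have h1 : |x * w + τ * (w ^ 4 + α * w ^ 2)| ≤ |x| * w + |τ| * (2 * w ^ 4) := by
      refine (abs_add_le _ _).trans ?_
      rw [abs_mul, abs_mul, abs_of_pos hw0]
      refine add_le_add le_rfl (mul_le_mul_of_nonneg_left ?_ (abs_nonneg τ))
      refine (abs_add_le _ _).trans ?_
      rw [abs_mul, abs_of_pos (pow_pos hw0 4), abs_of_pos (pow_pos hw0 2)]
      have : w ^ 2 ≤ w ^ 4 := pow_le_pow_right₀ hw.1.le (by norm_num)
      nlinarith [pow_pos hw0 2]
    have h2 : |τ| * (2 * w ^ 4) * M ≤ 2 * w := by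
      have h3 : w ^ 3 ≤ M ^ 3 := pow_le_pow_left₀ hw0.le hw.2 3
      have h4 : |τ| * w ^ 3 * M ≤ 1 := by
        refine le_trans ?_ hτ
        rw [mul_assoc]
        refine mul_le_mul_of_nonneg_left ?_ (abs_nonneg τ)
        nlinarith
      nlinarith
    calc _ ≤ |x * w + τ * (w ^ 4 + α * w ^ 2)| * M :=
          mul_le_mul_of_nonneg_right (Real.norm_exp_I_mul_ofReal_sub_one_le) hM0.le
      _ ≤ (|x| * w + |τ| * (2 * w ^ 4)) * M := mul_le_mul_of_nonneg_right h1 hM0.le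
      _ ≤ 3 * w := by nlinarith [mul_le_mul_of_nonneg_right hx hw0.le]
  · rw [abs_of_nonneg (by linarith), div_mul_eq_mul_div, div_le_iff₀ hM0]
    linarith

theorem log_sub_le_norm_oscLimit {α x τ M : ℝ} (hα : |α| ≤ 1) (hM : 1 ≤ M)
    (hmax : max (|x| * M) (|τ| * M ^ 4) = 1) :
    Real.log M - 25 ≤ ‖oscLimit α x τ‖ := by
  have hM0 : 0 < M := one_pos.trans_le hM
  have hx : |x| * M ≤ 1 := hmax ▸ le_max_left _ _
  have hτ : |τ| * M ^ 4 ≤ 1 := hmax ▸ le_max_right _ _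
  have hcase : |x| * M = 1 ∨ |τ| * M ^ 4 = 1 := by
    rcases max_choice (|x| * M) (|τ| * M ^ 4) with h | h
    · exact Or.inl (h.symm.trans hmax)
    · exact Or.inr (h.symm.trans hmax)
  have hne : x ≠ 0 ∨ τ ≠ 0 := by
    rcases hcase with h | h
    · left; rintro rfl; simp at h
    · right; rintro rfl; simp at h
  -- If `|x| M = 1` the tail is at most `20 + log 3`; if `|τ| M⁴ = 1`, the level `l = 1 / M` gives
  -- `10 + 1 / 5`.
  have htail : ‖oscLimit α x τ - oscIntegral α 1 M x τ‖ ≤ 22 := by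
    refine norm_oscLimit_sub_le hM (tendsto_oscIntegral hα hne) fun B hB => ?_
    rcases hcase with h | h
    · have hx0 : x ≠ 0 := by rintro rfl; simp at h
      refine (norm_oscIntegral_le_of_space hα hM hB hx0).trans ?_
      have := Real.log_le_sub_one_of_pos (show (0 : ℝ) < 3 by norm_num)
      rw [h]
      linarith
    · have hτ0 : τ ≠ 0 := by rintro rfl; simp at h
      refine (norm_oscIntegral_le_of_time hα hM hB (inv_pos.2 hM0) hτ0).trans ?_
      have e : 5 * |τ| * M ^ 3 = 5 * M⁻¹ := by
        field_simp
        linarith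
      rw [e, inv_mul_cancel₀ hM0.ne', div_mul_cancel_right₀ (inv_pos.2 hM0).ne']
      norm_num
  have h1 := norm_oscIntegral_sub_log_le hα hM hx hτ
  have h2 : ‖(Real.log M : ℂ)‖ = Real.log M := by
    rw [Complex.norm_real, Real.norm_of_nonneg (Real.log_nonneg hM)]
  have h3 : (Real.log M : ℂ) = oscLimit α x τ - (oscLimit α x τ - oscIntegral α 1 M x τ)
      - (oscIntegral α 1 M x τ - (Real.log M : ℂ)) := by ring
  have h4 : ‖(Real.log M : ℂ)‖ ≤ ‖oscLimit α x τ‖ + ‖oscLimit α x τ - oscIntegral α 1 M x τ‖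
      + ‖oscIntegral α 1 M x τ - (Real.log M : ℂ)‖ := by
    conv_lhs => rw [h3]
    exact (norm_sub_le _ _).trans (add_le_add (norm_sub_le _ _) le_rfl)
  linarith

theorem exists_scale {x τ K : ℝ} (hK : 1 ≤ K) (hne : x ≠ 0 ∨ τ ≠ 0)
    (hx : |x| * K ≤ 1) (hτ : |τ| * K ^ 4 ≤ 1) :
    ∃ M, K ≤ M ∧ max (|x| * M) (|τ| * M ^ 4) = 1 := by
  have hbig : ∃ L, K ≤ L ∧ 1 ≤ max (|x| * L) (|τ| * L ^ 4) := by
    rcases hne with h | h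
    · have h0 := abs_pos.2 h
      refine ⟨K + |x|⁻¹, by simp, le_max_of_le_left ?_⟩
      rw [mul_add, mul_inv_cancel₀ h0.ne']
      nlinarith
    · have h0 := abs_pos.2 h
      refine ⟨K + |τ|⁻¹, by simp, le_max_of_le_right ?_⟩
      have h1 : 1 ≤ K + |τ|⁻¹ := hK.trans (by simp)
      have h2 : K + |τ|⁻¹ ≤ (K + |τ|⁻¹) ^ 4 := le_self_pow₀ h1 (by norm_num)
      refine le_trans ?_ (mul_le_mul_of_nonneg_left h2 h0.le)
      rw [mul_add, mul_inv_cancel₀ h0.ne']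
      nlinarith
  obtain ⟨L, hKL, hL⟩ := hbig
  obtain ⟨M, hM, hM'⟩ := intermediate_value_Icc hKL
    (f := fun M => max (|x| * M) (|τ| * M ^ 4)) (by fun_prop) ⟨max_le hx hτ, hL⟩
  exact ⟨M, hM.1, hM'⟩

theorem tendsto_norm_oscLimit_atTop {α : ℝ} (hα : |α| ≤ 1) :
    Tendsto (fun z : ℝ × ℝ => ‖oscLimit α z.1 z.2‖) (𝓝[≠] (0, 0)) atTop := by
  refine tendsto_atTop.2 fun b => ?_
  -- Any scale `M ≥ K` gives `log M - 25 ≥ |b|`.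
  set K : ℝ := Real.exp (|b| + 25) with hKdef
  have hK : 1 ≤ K := Real.one_le_exp (by positivity)
  have c1 : Tendsto (fun z : ℝ × ℝ => |z.1| * K) (𝓝 (0, 0)) (𝓝 0) := by
    have : Continuous fun z : ℝ × ℝ => |z.1| * K := by fun_prop
    simpa using this.tendsto (0, 0)
  have c2 : Tendsto (fun z : ℝ × ℝ => |z.2| * K ^ 4) (𝓝 (0, 0)) (𝓝 0) := by
    have : Continuous fun z : ℝ × ℝ => |z.2| * K ^ 4 := by fun_prop
    simpa using this.tendsto (0, 0)
  filter_upwards [self_mem_nhdsWithin,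
    mem_nhdsWithin_of_mem_nhds (c1.eventually_lt_const one_pos),
    mem_nhdsWithin_of_mem_nhds (c2.eventually_lt_const one_pos)] with z hz h1 h2
  have hne : z.1 ≠ 0 ∨ z.2 ≠ 0 := by
    by_contra! h
    exact hz (Prod.ext h.1 h.2)
  obtain ⟨M, hKM, hM⟩ := exists_scale hK hne (le_of_lt h1) (le_of_lt h2)
  have h3 := log_sub_le_norm_oscLimit hα (hK.trans hKM) hM
  have h4 : |b| + 25 ≤ Real.log M := by
    rw [← Real.log_exp (|b| + 25)]
    exact Real.log_le_log (Real.exp_pos _) hKM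
  linarith [le_abs_self b]

/-! ### Smoothness of the oscillatory integral for nonzero time -/

/-- Each differentiation in `x` replaces `h` by `g h`, which again satisfies the hypotheses; hence
an induction over all `h`. The bound on `Re g` gives the locally uniform factor `exp |x|`. -/
theorem contDiff_integral_exp_mul {X : Type*} [MeasurableSpace X] {ν : Measure X} {g : X → ℂ}
    (hg : AEStronglyMeasurable g ν) (hre : ∀ᵐ s ∂ν, |(g s).re| ≤ 1) {h : X → ℂ}
    (hh : AEStronglyMeasurable h ν) (hint : ∀ k : ℕ, Integrable (fun s => ‖g s‖ ^ k * ‖h s‖) ν) :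
    ContDiff ℝ ∞ fun x : ℝ => ∫ s, Complex.exp ((x : ℂ) * g s) * h s ∂ν := by
  refine contDiff_infty.2 fun n => ?_
  have hmeas : ∀ (h : X → ℂ), AEStronglyMeasurable h ν → ∀ x : ℝ,
      AEStronglyMeasurable (fun s => Complex.exp ((x : ℂ) * g s) * h s) ν := fun h hh x =>
    (Complex.continuous_exp.comp_aestronglyMeasurable (hg.const_mul _)).mul hh
  have hexp : ∀ᵐ s ∂ν, ∀ x : ℝ, ‖Complex.exp ((x : ℂ) * g s)‖ ≤ Real.exp |x| := by
    filter_upwards [hre] with s hs x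
    rw [Complex.norm_exp, Complex.re_ofReal_mul]
    refine Real.exp_le_exp.2 ((le_abs_self _).trans ?_)
    rw [abs_mul]
    exact mul_le_of_le_one_right (abs_nonneg x) hs
  have hderiv : ∀ (h : X → ℂ), AEStronglyMeasurable h ν →
      (∀ k : ℕ, Integrable (fun s => ‖g s‖ ^ k * ‖h s‖) ν) → ∀ x : ℝ,
      HasDerivAt (fun x : ℝ => ∫ s, Complex.exp ((x : ℂ) * g s) * h s ∂ν)
        (∫ s, Complex.exp ((x : ℂ) * g s) * (g s * h s) ∂ν) x := by
    intro h hh hint x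
    refine (hasDerivAt_integral_of_dominated_loc_of_deriv_le (s := Metric.ball x 1)
      (bound := fun s => Real.exp (|x| + 1) * (‖g s‖ ^ 1 * ‖h s‖))
      (F' := fun (x : ℝ) s => Complex.exp ((x : ℂ) * g s) * (g s * h s))
      (Metric.ball_mem_nhds x one_pos) (Eventually.of_forall (hmeas h hh)) ?_
      (hmeas _ (hg.mul hh) x) ?_ ((hint 1).const_mul _) ?_).2
    · refine ((hint 0).const_mul (Real.exp |x|)).mono' (hmeas h hh x) ?_
      filter_upwards [hexp] with s hs
      rw [norm_mul, pow_zero, one_mul]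
      exact mul_le_mul_of_nonneg_right (hs x) (norm_nonneg _)
    · filter_upwards [hexp] with s hs y hy
      rw [norm_mul, norm_mul, pow_one]
      refine mul_le_mul_of_nonneg_right ((hs y).trans (Real.exp_le_exp.2 ?_)) (by positivity)
      have h1 : |y - x| < 1 := by rwa [Metric.mem_ball, Real.dist_eq] at hy
      have h2 := abs_sub_abs_le_abs_sub y x
      linarith
    · refine Eventually.of_forall fun s y _ => ?_
      have h1 : HasDerivAt (fun y : ℝ => (y : ℂ) * g s) (g s) y := by
        simpa using (Complex.ofRealCLM.hasDerivAt (x := y)).mul_const (g s)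
      exact (h1.cexp.mul_const (h s)).congr_deriv (by ring)
  induction n generalizing h with
  | zero =>
    exact contDiff_zero.2 (continuous_iff_continuousAt.2 fun x =>
      (hderiv h hh hint x).continuousAt)
  | succ n ih =>
    push_cast
    refine contDiff_succ_iff_deriv.2 ⟨fun x => (hderiv h hh hint x).differentiableAt,
      fun hn => absurd hn (by simp), ?_⟩
    have e : deriv (fun x : ℝ => ∫ s, Complex.exp ((x : ℂ) * g s) * h s ∂ν)
        = fun x : ℝ => ∫ s, Complex.exp ((x : ℂ) * g s) * (g s * h s) ∂ν :=
      funext fun x => (hderiv h hh hint x).deriv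
    rw [e]
    refine ih (hg.mul hh) fun k => ?_
    refine (hint (k + 1)).congr (Eventually.of_forall fun s => ?_)
    simp only [norm_mul]
    ring

/-- The holomorphic amplitude `exp (i τ (z⁴ + α z²)) / z`. -/
noncomputable def oscKernel (α τ : ℝ) (z : ℂ) : ℂ :=
  Complex.exp (Complex.I * ((τ : ℂ) * (z ^ 4 + α * z ^ 2))) * z⁻¹

/-- The exponent has real part `-τ y (4 w³ - 4 w y² + 2 α w)`, so moving into the upper half-plane
gains decay for large `w` when `τ > 0`. -/
theorem norm_oscKernel_le {α τ w y : ℝ} (hα : |α| ≤ 1) (hτ : 0 ≤ τ) (hw : 1 ≤ w) (hy : 0 ≤ y)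
    (hy1 : y ≤ 1) :
    ‖oscKernel α τ ((w : ℂ) + y * Complex.I)‖ ≤ Real.exp (-(τ * y * (4 * w ^ 3 - 6 * w))) / w := by
  have hw0 : 0 < w := one_pos.trans_le hw
  have hα' := abs_le.1 hα
  rw [oscKernel, norm_mul, norm_inv, div_eq_mul_inv]
  refine mul_le_mul ?_ (inv_anti₀ hw0 ?_) (by positivity) (Real.exp_pos _).le
  · rw [Complex.norm_exp]
    refine Real.exp_le_exp.2 ?_
    have e : (Complex.I * ((τ : ℂ) * (((w : ℂ) + y * Complex.I) ^ 4
        + α * ((w : ℂ) + y * Complex.I) ^ 2))).re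
        = -(τ * y * (4 * w ^ 3 - 4 * w * y ^ 2 + 2 * α * w)) := by
      simp [pow_succ]
      ring
    rw [e, neg_le_neg_iff]
    refine mul_le_mul_of_nonneg_left ?_ (mul_nonneg hτ hy)
    have : y ^ 2 ≤ 1 := pow_le_one₀ hy hy1
    nlinarith
  · have := Complex.abs_re_le_norm ((w : ℂ) + y * Complex.I)
    simpa [abs_of_pos hw0] using this

theorem differentiableAt_oscKernel (α τ : ℝ) {z : ℂ} (hz : z ≠ 0) :
    DifferentiableAt ℂ (oscKernel α τ) z := by
  unfold oscKernel
  fun_prop (disch := assumption)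

theorem add_mul_I_ne_zero {w : ℝ} (hw : 0 < w) (y : ℝ) : (w : ℂ) + y * Complex.I ≠ 0 := fun h => by
  have := congrArg Complex.re h
  simp at this
  exact hw.ne' this

theorem continuousOn_oscKernel_add_mul_I (α τ y : ℝ) {s : Set ℝ} (hs : ∀ w ∈ s, 0 < w) :
    ContinuousOn (fun w : ℝ => oscKernel α τ ((w : ℂ) + y * Complex.I)) s := fun w hw =>
  ContinuousAt.continuousWithinAt <| ContinuousAt.comp
    (f := fun w : ℝ => (w : ℂ) + y * Complex.I)
    (differentiableAt_oscKernel α τ (add_mul_I_ne_zero (hs w hw) y)).continuousAt (by fun_prop)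

theorem continuous_oscKernel_vertical (α τ : ℝ) {w : ℝ} (hw : 0 < w) :
    Continuous fun y : ℝ => oscKernel α τ ((w : ℂ) + y * Complex.I) :=
  continuous_iff_continuousAt.2 fun y => ContinuousAt.comp
    (f := fun y : ℝ => (w : ℂ) + y * Complex.I)
    (differentiableAt_oscKernel α τ (add_mul_I_ne_zero hw y)).continuousAt (by fun_prop)

theorem integrableOn_pow_mul_oscKernel {α τ : ℝ} (hα : |α| ≤ 1) (hτ : 0 < τ) (k : ℕ) :
    IntegrableOn (fun w : ℝ => ‖Complex.I * ((w : ℂ) + (1 : ℝ) * Complex.I)‖ ^ k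
      * ‖oscKernel α τ ((w : ℂ) + (1 : ℝ) * Complex.I)‖) (Set.Ioi 1) := by
  refine integrable_of_isBigO_exp_neg (b := τ / 2) (half_pos hτ) ?_ ?_
  · refine ContinuousOn.mul (by fun_prop) (ContinuousOn.norm ?_)
    exact continuousOn_oscKernel_add_mul_I α τ 1 fun w hw => one_pos.trans_le hw
  · have h1 : (fun w : ℝ => ‖Complex.I * ((w : ℂ) + (1 : ℝ) * Complex.I)‖ ^ k
        * ‖oscKernel α τ ((w : ℂ) + (1 : ℝ) * Complex.I)‖)
        =O[atTop] fun w => w ^ k * Real.exp (-τ * w) := by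
      refine Asymptotics.IsBigO.of_bound (2 ^ k * Real.exp (3 * τ)) ?_
      filter_upwards [eventually_ge_atTop (1 : ℝ)] with w hw
      have hw0 : 0 < w := one_pos.trans_le hw
      have b1 : ‖Complex.I * ((w : ℂ) + (1 : ℝ) * Complex.I)‖ ≤ 2 * w := by
        rw [norm_mul, Complex.norm_I, one_mul]
        refine (norm_add_le _ _).trans ?_
        simp [abs_of_pos hw0]
        linarith
      have b2 : ‖oscKernel α τ ((w : ℂ) + (1 : ℝ) * Complex.I)‖
          ≤ Real.exp (3 * τ) * Real.exp (-τ * w) := by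
        refine (norm_oscKernel_le hα hτ.le hw zero_le_one le_rfl).trans
          ((div_le_self (Real.exp_pos _).le hw).trans ?_)
        rw [← Real.exp_add]
        refine Real.exp_le_exp.2 ?_
        -- `4 w³ - 7 w + 3 = (w - 1)(4 w² + 4 w - 3) ≥ 0`, which explains the factor `exp (3 τ)`.
        nlinarith [mul_nonneg hτ.le (show 0 ≤ 4 * w ^ 3 - 7 * w + 3 by
          nlinarith [mul_nonneg (sub_nonneg.2 hw) (sq_nonneg w),
            mul_nonneg (sub_nonneg.2 hw) (sub_nonneg.2 hw)])]
      rw [Real.norm_of_nonneg (by positivity), Real.norm_of_nonneg (by positivity)]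
      calc _ ≤ (2 * w) ^ k * (Real.exp (3 * τ) * Real.exp (-τ * w)) :=
            mul_le_mul (pow_le_pow_left₀ (norm_nonneg _) b1 k) b2 (norm_nonneg _) (by positivity)
        _ = _ := by rw [mul_pow]; ring
    refine h1.trans ?_
    have h2 := ((isLittleO_pow_exp_pos_mul_atTop k (half_pos hτ)).isBigO).mul
      (Asymptotics.isBigO_refl (fun w : ℝ => Real.exp (-τ * w)) atTop)
    refine h2.congr_right fun w => ?_
    rw [← Real.exp_add]
    congr 1
    ring

theorem norm_exp_mul_I_mul_le (x w : ℝ) {y : ℝ} (hy : 0 ≤ y) (hy1 : y ≤ 1) :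
    ‖Complex.exp ((x : ℂ) * (Complex.I * ((w : ℂ) + y * Complex.I)))‖ ≤ Real.exp |x| := by
  rw [Complex.norm_exp]
  refine Real.exp_le_exp.2 ?_
  have e : ((x : ℂ) * (Complex.I * ((w : ℂ) + y * Complex.I))).re = -(x * y) := by simp
  rw [e]
  refine (neg_le_abs _).trans ?_
  rw [abs_mul, abs_of_nonneg hy]
  exact mul_le_of_le_one_right (abs_nonneg x) hy1

/-- Shifting the contour of integration to `Im z = 1`. -/
theorem oscLimit_eq_shift {α τ : ℝ} (hα : |α| ≤ 1) (hτ : 0 < τ) (x : ℝ) :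
    oscLimit α x τ
      = (∫ w in Set.Ioi (1 : ℝ), Complex.exp ((x : ℂ) * (Complex.I * ((w : ℂ)
            + (1 : ℝ) * Complex.I))) * oscKernel α τ ((w : ℂ) + (1 : ℝ) * Complex.I))
        + Complex.I * ∫ y in Set.Ioc (0 : ℝ) 1, Complex.exp ((x : ℂ) * (Complex.I *
            (((1 : ℝ) : ℂ) + y * Complex.I))) * oscKernel α τ (((1 : ℝ) : ℂ) + y * Complex.I) := by
  set f : ℂ → ℂ := fun z => Complex.exp ((x : ℂ) * (Complex.I * z)) * oscKernel α τ z with hf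
  have hfd : ∀ z : ℂ, z ≠ 0 → DifferentiableAt ℂ f z := fun z hz =>
    DifferentiableAt.mul (by fun_prop) (differentiableAt_oscKernel α τ hz)
  have hosc : ∀ B, oscIntegral α 1 B x τ = ∫ w in (1 : ℝ)..B, f ((w : ℂ) + (0 : ℝ) * Complex.I) := by
    intro B
    refine intervalIntegral.integral_congr fun w _ => ?_
    simp only [hf, oscKernel]
    rw [← mul_assoc, ← Complex.exp_add]
    push_cast
    congr 2
    · ring_nf
    · ring_nf
  -- Cauchy's theorem on the rectangle `[1, B] × [0, 1]`; its right side disappears as `B → ∞`.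
  have hrect : ∀ B : ℝ, 1 ≤ B → oscIntegral α 1 B x τ
      = (∫ w in (1 : ℝ)..B, f ((w : ℂ) + (1 : ℝ) * Complex.I))
        + Complex.I * (∫ y in (0 : ℝ)..1, f (((1 : ℝ) : ℂ) + y * Complex.I))
        - Complex.I * ∫ y in (0 : ℝ)..1, f ((B : ℂ) + y * Complex.I) := by
    intro B hB
    have h := Complex.integral_boundary_rect_eq_zero_of_differentiableOn f
      (((1 : ℝ) : ℂ) + (0 : ℝ) * Complex.I) ((B : ℂ) + (1 : ℝ) * Complex.I) ?_
    · simp only [Complex.add_re, Complex.add_im, Complex.re_ofReal_mul, Complex.im_ofReal_mul,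
        Complex.I_re, Complex.I_im, Complex.ofReal_re, Complex.ofReal_im, mul_zero, mul_one,
        add_zero, zero_add, smul_eq_mul] at h
      rw [hosc]
      linear_combination h
    · intro z hz
      refine (hfd z fun h0 => ?_).differentiableWithinAt
      have := hz.1
      simp [h0, Set.uIcc_of_le hB] at this
      linarith
  have hlim1 : Tendsto (fun B : ℝ => ∫ w in (1 : ℝ)..B, f ((w : ℂ) + (1 : ℝ) * Complex.I)) atTop
      (𝓝 (∫ w in Set.Ioi (1 : ℝ), f ((w : ℂ) + (1 : ℝ) * Complex.I))) := by
    refine intervalIntegral_tendsto_integral_Ioi 1 ?_ tendsto_id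
    refine ((integrableOn_pow_mul_oscKernel hα hτ 0).const_mul (Real.exp |x|)).mono' ?_ ?_
    · refine ContinuousOn.aestronglyMeasurable (ContinuousOn.mul (by fun_prop) ?_) measurableSet_Ioi
      exact continuousOn_oscKernel_add_mul_I α τ 1 fun w hw => one_pos.trans hw
    · refine Eventually.of_forall fun w => ?_
      simp only [hf]
      rw [norm_mul, pow_zero, one_mul]
      exact mul_le_mul_of_nonneg_right (norm_exp_mul_I_mul_le x w zero_le_one le_rfl)
        (norm_nonneg _)
  have hlim2 : Tendsto (fun B : ℝ => ∫ y in (0 : ℝ)..1, f ((B : ℂ) + y * Complex.I)) atTop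
      (𝓝 0) := by
    have hz : Tendsto (fun B : ℝ => Real.exp |x| / B) atTop (𝓝 0) :=
      tendsto_const_nhds.div_atTop tendsto_id
    refine squeeze_zero_norm' ?_ hz
    -- From `B ≥ 2` on, `4 B³ - 6 B ≥ 0`, so the exponential is at most 1 on the whole side.
    filter_upwards [eventually_ge_atTop (2 : ℝ)] with B hB
    refine (intervalIntegral.norm_integral_le_of_norm_le_const (C := Real.exp |x| / B)
      fun y hy => ?_).trans (by simp)
    rw [Set.uIoc_of_le zero_le_one] at hy
    simp only [hf]
    rw [norm_mul, div_eq_mul_inv]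
    refine mul_le_mul (norm_exp_mul_I_mul_le x B hy.1.le hy.2) ?_ (norm_nonneg _)
      (Real.exp_pos _).le
    refine (norm_oscKernel_le hα hτ.le (by linarith) hy.1.le hy.2).trans ?_
    rw [← one_div]
    refine div_le_div_of_nonneg_right (Real.exp_le_one_iff.2 ?_) (by linarith)
    rw [neg_nonpos]
    exact mul_nonneg (mul_nonneg hτ.le hy.1.le) (by nlinarith [sq_nonneg B])
  rw [← intervalIntegral.integral_of_le zero_le_one]
  refine tendsto_nhds_unique (tendsto_oscIntegral (x := x) hα (Or.inr hτ.ne')) ?_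
  have h := (hlim1.add_const (Complex.I * (∫ y in (0 : ℝ)..1,
    f (((1 : ℝ) : ℂ) + y * Complex.I)))).sub (hlim2.const_mul Complex.I)
  rw [mul_zero, sub_zero] at h
  refine h.congr' ?_
  filter_upwards [eventually_ge_atTop (1 : ℝ)] with B hB
  exact (hrect B hB).symm

theorem contDiff_oscLimit_of_pos {α τ : ℝ} (hα : |α| ≤ 1) (hτ : 0 < τ) :
    ContDiff ℝ ∞ fun x : ℝ => oscLimit α x τ := by
  rw [funext (oscLimit_eq_shift hα hτ)]
  refine ContDiff.add ?_ (contDiff_const.mul ?_)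
  · refine contDiff_integral_exp_mul (by fun_prop) (Eventually.of_forall fun w => by simp) ?_
      (integrableOn_pow_mul_oscKernel hα hτ)
    exact (continuousOn_oscKernel_add_mul_I α τ 1
      fun w hw => one_pos.trans hw).aestronglyMeasurable measurableSet_Ioi
  · have hc := continuous_oscKernel_vertical α τ one_pos
    refine contDiff_integral_exp_mul (by fun_prop) ?_ hc.aestronglyMeasurable fun k => ?_
    · filter_upwards [ae_restrict_mem measurableSet_Ioc] with y hy
      simpa [abs_of_pos hy.1] using hy.2
    · refine (Continuous.integrableOn_Icc ?_).mono_set Set.Ioc_subset_Icc_self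
      exact Continuous.mul (by fun_prop) hc.norm

theorem oscLimit_neg {α x τ : ℝ} (hα : |α| ≤ 1) (hτ : τ ≠ 0) :
    oscLimit α x τ = (starRingEnd ℂ) (oscLimit α (-x) (-τ)) := by
  have h := ((Complex.continuous_conj.tendsto _).comp
    (tendsto_oscIntegral (x := -x) (τ := -τ) hα (Or.inr (neg_ne_zero.2 hτ))))
  refine tendsto_nhds_unique (tendsto_oscIntegral hα (Or.inr hτ)) (h.congr fun B => ?_)
  simp only [Function.comp_apply]
  rw [conj_oscIntegral, neg_neg, neg_neg]

theorem contDiff_oscLimit {α τ : ℝ} (hα : |α| ≤ 1) (hτ : τ ≠ 0) :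
    ContDiff ℝ ∞ fun x : ℝ => oscLimit α x τ := by
  rcases hτ.lt_or_gt with h | h
  · have e : (fun x : ℝ => oscLimit α x τ)
        = fun x => Complex.conjCLE (oscLimit α (-x) (-τ)) :=
      funext fun x => oscLimit_neg hα hτ
    rw [e]
    exact Complex.conjCLE.contDiff.comp
      ((contDiff_oscLimit_of_pos hα (neg_pos.2 h)).comp contDiff_neg)
  · exact contDiff_oscLimit_of_pos hα h

/-! ### The equation on the Fourier side -/

/-- The symbol `(2πη)⁴ + α (2πη)²` of the operator `∂⁴ - α ∂²`. -/
noncomputable def fourthOrderSymbol (α η : ℝ) : ℝ :=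
  (2 * Real.pi * η) ^ 4 + α * (2 * Real.pi * η) ^ 2

theorem contDiff_fourthOrderSymbol (α : ℝ) {n : WithTop ℕ∞} :
    ContDiff ℝ n (fourthOrderSymbol α) := by
  unfold fourthOrderSymbol
  fun_prop

theorem hasTemperateGrowth_fourthOrderSymbol (α : ℝ) :
    Function.HasTemperateGrowth fun η : ℝ => (fourthOrderSymbol α η : ℂ) := by
  unfold fourthOrderSymbol
  push_cast
  fun_prop

/-- Multiplication of a Schwartz function by the symbol. -/
noncomputable def symbolMul (α : ℝ) (ψ : 𝓢(ℝ, ℂ)) : 𝓢(ℝ, ℂ) :=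
  SchwartzMap.smulLeftCLM ℂ (fun η : ℝ => (fourthOrderSymbol α η : ℂ)) ψ

theorem symbolMul_apply (α : ℝ) (ψ : 𝓢(ℝ, ℂ)) (η : ℝ) :
    symbolMul α ψ η = (fourthOrderSymbol α η : ℂ) * ψ η :=
  SchwartzMap.smulLeftCLM_apply_apply (hasTemperateGrowth_fourthOrderSymbol α) ψ η

theorem integrable_L2_mul_schwartz (f : L2R) (ψ : 𝓢(ℝ, ℂ)) :
    Integrable fun x : ℝ => f x * ψ x :=
  MemLp.integrable_mul (Lp.memLp f) (ψ.memLp 2)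

theorem integral_mul_fourier_eq (f : L2R) (ψ : 𝓢(ℝ, ℂ)) :
    ∫ x : ℝ, f x * (𝓕 ψ) x = ∫ x : ℝ, (𝓕 f : L2R) x * ψ x := by
  have h := congrArg (fun T : 𝓢'(ℝ, ℂ) => T ψ) (Lp.fourier_toTemperedDistribution_eq f)
  simp only [TemperedDistribution.fourier_apply, Lp.toTemperedDistribution_apply,
    smul_eq_mul] at h
  simpa only [mul_comm] using h

theorem iteratedDeriv_fourier_schwartz (n : ℕ) (ψ : 𝓢(ℝ, ℂ)) (x : ℝ) :
    iteratedDeriv n (fun y => (𝓕 ψ) y) x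
      = (𝓕 (SchwartzMap.smulLeftCLM ℂ
          (fun y : ℝ => (-2 * Real.pi * Complex.I * y : ℂ) ^ n) ψ)) x := by
  have hg : Function.HasTemperateGrowth (fun y : ℝ => (-2 * Real.pi * Complex.I * y : ℂ) ^ n) := by
    fun_prop
  have h := Real.iteratedDeriv_fourier (f := (ψ : ℝ → ℂ)) (N := ⊤) (n := n) (fun k _ => ?_) le_top
  · have e : (fun y => (𝓕 ψ) y) = 𝓕 (ψ : ℝ → ℂ) := by
      funext y
      rw [SchwartzMap.fourier_coe]
    rw [e, h, SchwartzMap.fourier_coe, SchwartzMap.smulLeftCLM_apply hg]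
  · have hk : Function.HasTemperateGrowth (fun y : ℝ => (y : ℂ) ^ k) := by fun_prop
    refine (SchwartzMap.smulLeftCLM ℂ (fun y : ℝ => (y : ℂ) ^ k) ψ).integrable.congr
      (Eventually.of_forall fun y => ?_)
    rw [SchwartzMap.smulLeftCLM_apply_apply hk]
    simp

theorem integral_operator_fourier_eq (α : ℝ) (f : L2R) (ψ : 𝓢(ℝ, ℂ)) :
    -((α : ℂ) * ∫ x : ℝ, f x * iteratedDeriv 2 (fun y => (𝓕 ψ) y) x)
        + ∫ x : ℝ, f x * iteratedDeriv 4 (fun y => (𝓕 ψ) y) x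
      = ∫ x : ℝ, (𝓕 f : L2R) x * symbolMul α ψ x := by
  simp only [iteratedDeriv_fourier_schwartz]
  rw [integral_mul_fourier_eq, integral_mul_fourier_eq, ← integral_const_mul, ← integral_neg,
    ← integral_add ((integrable_L2_mul_schwartz _ _).const_mul _).fun_neg
      (integrable_L2_mul_schwartz _ _)]
  refine integral_congr_ae (Eventually.of_forall fun x => ?_)
  simp only [symbolMul_apply]
  rw [SchwartzMap.smulLeftCLM_apply_apply (by fun_prop),
    SchwartzMap.smulLeftCLM_apply_apply (by fun_prop)]
  simp only [fourthOrderSymbol, smul_eq_mul]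
  push_cast
  ring_nf
  rw [Complex.I_sq, show Complex.I ^ 4 = 1 from Complex.I_pow_four]
  ring

/-- Every Schwartz function is some `𝓕 ψ`; testing with these turns the differential operator into
multiplication of `ψ` by the symbol. -/
theorem isFourthOrderSolution_iff {α : ℝ} {u₀ : ℝ → ℂ} {U : ℝ →ᵇ L2R} :
    IsFourthOrderSolution α u₀ U ↔ (U 0 : ℝ → ℂ) =ᵐ[volume] u₀ ∧
      ∀ (ψ : 𝓢(ℝ, ℂ)) (t : ℝ), HasDerivAt (fun s : ℝ => ∫ x : ℝ, (𝓕 (U s) : L2R) x * ψ x)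
        (Complex.I * ∫ x : ℝ, (𝓕 (U t) : L2R) x * symbolMul α ψ x) t := by
  have hI : Complex.I * Complex.I = -1 := Complex.I_mul_I
  constructor
  · refine fun h => ⟨h.initial, fun ψ t => ?_⟩
    have h1 := (h.differentiable (𝓕 ψ) t).hasDerivAt
    have h2 := h.equation (𝓕 ψ) t
    have h3 := integral_operator_fourier_eq α (U t) ψ
    rw [← h3]
    simp only [← integral_mul_fourier_eq]
    refine h1.congr_deriv ?_
    linear_combination (-Complex.I) * h2 +
      deriv (fun s : ℝ => ∫ x : ℝ, U s x * (𝓕 ψ) x) t * hI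
  · rintro ⟨h0, h⟩
    have key : ∀ (φ : 𝓢(ℝ, ℂ)) (t : ℝ), HasDerivAt (fun s : ℝ => ∫ x : ℝ, U s x * φ x)
        (Complex.I * (-((α : ℂ) * ∫ x : ℝ, U t x * iteratedDeriv 2 (fun y => φ y) x)
          + ∫ x : ℝ, U t x * iteratedDeriv 4 (fun y => φ y) x)) t := by
      intro φ t
      obtain ⟨ψ, rfl⟩ : ∃ ψ : 𝓢(ℝ, ℂ), φ = 𝓕 ψ :=
        ⟨𝓕⁻ φ, (FourierTransform.fourier_fourierInv_eq φ).symm⟩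
      rw [integral_operator_fourier_eq]
      simp only [integral_mul_fourier_eq]
      exact h ψ t
    refine ⟨h0, fun φ t => (key φ t).differentiableAt, fun φ t => ?_⟩
    rw [(key φ t).deriv]
    linear_combination (-((α : ℂ) * ∫ x : ℝ, U t x * iteratedDeriv 2 (fun y => φ y) x)
          + ∫ x : ℝ, U t x * iteratedDeriv 4 (fun y => φ y) x) * hI

/-! ### The unitary group on the Fourier side -/

theorem tendsto_L2_of_dominated {ι : Type*} {l : Filter ι} [l.IsCountablyGenerated]
    {F : ι → L2R} {G : L2R} {f : ι → ℝ → ℂ} {g : ℝ → ℂ} {b : ℝ → ℝ}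
    (hF : ∀ i, (F i : ℝ → ℂ) =ᵐ[volume] f i) (hG : (G : ℝ → ℂ) =ᵐ[volume] g)
    (hb : Integrable fun x => b x ^ 2) (hfb : ∀ i, ∀ᵐ x, ‖f i x‖ ≤ b x)
    (hgb : ∀ᵐ x, ‖g x‖ ≤ b x) (hlim : ∀ᵐ x, Tendsto (fun i => f i x) l (𝓝 (g x))) :
    Tendsto F l (𝓝 G) := by
  have hsq : ∀ i, ‖F i - G‖ ^ 2 = ∫ x, ‖f i x - g x‖ ^ 2 := by
    intro i
    have h1 : ((‖F i - G‖ ^ 2 : ℝ) : ℂ) = ((∫ x, ‖f i x - g x‖ ^ 2 : ℝ) : ℂ) := by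
      rw [← integral_complex_ofReal]
      push_cast
      have h0 : inner ℂ (F i - G) (F i - G) = (‖F i - G‖ : ℂ) ^ 2 :=
        inner_self_eq_norm_sq_to_K (𝕜 := ℂ) (F i - G)
      rw [← h0, L2.inner_def]
      refine integral_congr_ae ?_
      filter_upwards [hF i, hG, Lp.coeFn_sub (F i) G] with x h1 h2 h3
      rw [h3, Pi.sub_apply, h1, h2, inner_self_eq_norm_sq_to_K (𝕜 := ℂ)]
      rfl
    exact_mod_cast h1
  have hmeas : ∀ i, AEStronglyMeasurable (f i) volume := fun i =>
    (Lp.aestronglyMeasurable (F i)).congr (hF i)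
  have hmg : AEStronglyMeasurable g volume := (Lp.aestronglyMeasurable G).congr hG
  have h0 : Tendsto (fun i => ∫ x, ‖f i x - g x‖ ^ 2) l (𝓝 0) := by
    rw [← integral_zero ℝ ℝ (μ := volume)]
    refine tendsto_integral_filter_of_dominated_convergence (fun x => 4 * b x ^ 2)
      (Eventually.of_forall fun i => ?_) (Eventually.of_forall fun i => ?_) (hb.const_mul 4) ?_
    · exact ((hmeas i).sub hmg).norm.pow 2
    · filter_upwards [hfb i, hgb] with x h1 h2
      have h3 : ‖f i x - g x‖ ≤ 2 * b x := (norm_sub_le _ _).trans (by linarith)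
      rw [Real.norm_of_nonneg (by positivity)]
      nlinarith [norm_nonneg (f i x - g x)]
    · filter_upwards [hlim] with x hx
      have := ((hx.sub_const (g x)).norm.pow 2)
      simpa using this
  rw [tendsto_iff_norm_sub_tendsto_zero]
  have h1 : Tendsto (fun i => √(‖F i - G‖ ^ 2)) l (𝓝 0) := by
    simp only [hsq]
    simpa using h0.sqrt
  simpa using h1

/-- The phase `exp (i t ((2πη)⁴ + α (2πη)²))`. -/
noncomputable def phase (α t η : ℝ) : ℂ :=
  Complex.exp (Complex.I * ((t * fourthOrderSymbol α η : ℝ) : ℂ))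

theorem norm_phase (α t η : ℝ) : ‖phase α t η‖ = 1 := by
  rw [phase, mul_comm, Complex.norm_exp_ofReal_mul_I]

theorem contDiff_phase (α t : ℝ) {n : WithTop ℕ∞} : ContDiff ℝ n (phase α t) := by
  have := contDiff_fourthOrderSymbol α (n := n)
  exact (contDiff_const.mul (Complex.ofRealCLM.contDiff.comp (contDiff_const.mul this))).cexp

theorem hasDerivAt_phase (α η t : ℝ) :
    HasDerivAt (fun t => phase α t η)
      (Complex.I * (fourthOrderSymbol α η : ℂ) * phase α t η) t := by
  have h : HasDerivAt (fun t : ℝ => t * fourthOrderSymbol α η) (fourthOrderSymbol α η) t := by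
    simpa using (hasDerivAt_id t).mul_const (fourthOrderSymbol α η)
  exact (h.ofReal_comp.const_mul Complex.I).cexp.congr_deriv (by rw [phase]; ring)

theorem phase_add (α s t η : ℝ) : phase α (s + t) η = phase α s η * phase α t η := by
  rw [phase, phase, phase, ← Complex.exp_add]
  push_cast
  ring_nf

theorem conj_phase (α t η : ℝ) : (starRingEnd ℂ) (phase α t η) = phase α (-t) η := by
  rw [phase, phase, ← Complex.exp_conj, map_mul, Complex.conj_I, Complex.conj_ofReal]
  push_cast
  ring_nf

theorem memLp_phase_mul (α t : ℝ) (f : L2R) : MemLp (fun η => phase α t η * f η) 2 volume :=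
  (Lp.memLp f).of_le ((contDiff_phase α t (n := 0)).continuous.aestronglyMeasurable.mul
    (Lp.aestronglyMeasurable f)) (Eventually.of_forall fun η => by
      rw [norm_mul, norm_phase, one_mul])

/-- Multiplication by the phase, as a map on `L²(ℝ)`. -/
noncomputable def phaseMul (α t : ℝ) (f : L2R) : L2R := (memLp_phase_mul α t f).toLp

theorem coeFn_phaseMul (α t : ℝ) (f : L2R) :
    (phaseMul α t f : ℝ → ℂ) =ᵐ[volume] fun η => phase α t η * f η :=
  MemLp.coeFn_toLp _

theorem norm_phaseMul_le (α t : ℝ) (f : L2R) : ‖phaseMul α t f‖ ≤ ‖f‖ := by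
  refine Lp.norm_le_norm_of_ae_le ?_
  filter_upwards [coeFn_phaseMul α t f] with η h
  rw [h, norm_mul, norm_phase, one_mul]

theorem phaseMul_zero (α : ℝ) (f : L2R) : phaseMul α 0 f = f := by
  refine Lp.ext ?_
  filter_upwards [coeFn_phaseMul α 0 f] with η h
  rw [h, phase]
  simp

theorem integrable_norm_sq (f : L2R) : Integrable fun η : ℝ => ‖f η‖ ^ 2 :=
  (memLp_two_iff_integrable_sq_norm (Lp.aestronglyMeasurable f)).1 (Lp.memLp f)

theorem continuous_phaseMul (α : ℝ) (f : L2R) : Continuous fun t => phaseMul α t f := by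
  refine continuous_iff_continuousAt.2 fun t => ?_
  refine tendsto_L2_of_dominated (b := fun η => ‖f η‖) (fun s => coeFn_phaseMul α s f)
    (coeFn_phaseMul α t f) (integrable_norm_sq f) ?_ ?_ ?_
  · exact fun s => Eventually.of_forall fun η => by rw [norm_mul, norm_phase, one_mul]
  · exact Eventually.of_forall fun η => by rw [norm_mul, norm_phase, one_mul]
  · exact Eventually.of_forall fun η =>
      ((hasDerivAt_phase α η t).continuousAt.tendsto).mul_const (f η)

/-- The unbounded symbol is absorbed by `ψ`, which stays Schwartz; no decay of `f` beyond `L²` is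
needed. -/
theorem hasDerivAt_integral_phaseMul (α : ℝ) (f : L2R) (ψ : 𝓢(ℝ, ℂ)) (t : ℝ) :
    HasDerivAt (fun s : ℝ => ∫ x : ℝ, phaseMul α s f x * ψ x)
      (Complex.I * ∫ x : ℝ, phaseMul α t f x * symbolMul α ψ x) t := by
  have e : ∀ (s : ℝ) (χ : 𝓢(ℝ, ℂ)), ∫ x : ℝ, phaseMul α s f x * χ x
      = ∫ x : ℝ, phase α s x * (f x * χ x) := fun s χ => by
    refine integral_congr_ae ?_
    filter_upwards [coeFn_phaseMul α s f] with x h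
    rw [h, mul_assoc]
  simp only [e]
  rw [← integral_const_mul]
  have hm : ∀ s (χ : 𝓢(ℝ, ℂ)), AEStronglyMeasurable (fun x : ℝ => phase α s x * (f x * χ x))
      volume := fun s χ => (contDiff_phase α s (n := 0)).continuous.aestronglyMeasurable.mul
    (integrable_L2_mul_schwartz f χ).aestronglyMeasurable
  refine (hasDerivAt_integral_of_dominated_loc_of_deriv_le (s := Set.univ)
    (F' := fun (s : ℝ) x => Complex.I * (phase α s x * (f x * symbolMul α ψ x)))
    (bound := fun x => ‖f x * symbolMul α ψ x‖) univ_mem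
    (Eventually.of_forall fun s => hm s ψ) ?_ ((hm t _).const_mul _) ?_
    (integrable_L2_mul_schwartz f _).norm ?_).2
  · refine (integrable_L2_mul_schwartz f ψ).mono (hm t ψ) (Eventually.of_forall fun x => ?_)
    rw [norm_mul, norm_phase, one_mul]
  · exact Eventually.of_forall fun x s _ => by
      rw [norm_mul, Complex.norm_I, one_mul, norm_mul, norm_phase, one_mul]
  · refine Eventually.of_forall fun x s _ => ?_
    refine ((hasDerivAt_phase α x s).mul_const _).congr_deriv ?_
    rw [symbolMul_apply]
    ring

/-! ### Existence and uniqueness in `C_b(ℝ; L²(ℝ))` -/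

/-- The solution whose Fourier transform at time `0` is `f`. -/
noncomputable def fourthOrderFlow (α : ℝ) (f : L2R) : ℝ →ᵇ L2R :=
  BoundedContinuousFunction.ofNormedAddCommGroup (fun t => (𝓕⁻ (phaseMul α t f) : L2R))
    ((Lp.fourierTransformₗᵢ ℝ ℂ).symm.continuous.comp (continuous_phaseMul α f)) ‖f‖
    fun t => ((Lp.fourierTransformₗᵢ ℝ ℂ).symm.norm_map _).trans_le (norm_phaseMul_le α t f)

theorem fourthOrderFlow_apply (α : ℝ) (f : L2R) (t : ℝ) :
    fourthOrderFlow α f t = (𝓕⁻ (phaseMul α t f) : L2R) := rfl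

theorem isFourthOrderSolution_flow (α : ℝ) (f : L2R) {u₀ : ℝ → ℂ}
    (h0 : (fourthOrderFlow α f 0 : ℝ → ℂ) =ᵐ[volume] u₀) :
    IsFourthOrderSolution α u₀ (fourthOrderFlow α f) := by
  refine isFourthOrderSolution_iff.2 ⟨h0, fun ψ t => ?_⟩
  simp only [fourthOrderFlow_apply, FourierTransform.fourier_fourierInv_eq]
  exact hasDerivAt_integral_phaseMul α f ψ t

/-- A product rule for `f` merely continuous and weakly differentiable against the frozen vector `g
s`: split `g r = (g r - g s) + g s`. The transform of a solution has only this regularity. -/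
theorem hasDerivAt_inner_of_continuousAt {E : Type*} [NormedAddCommGroup E]
    [InnerProductSpace ℂ E] {g f : ℝ → E} {g' : E} {d : ℂ} {s : ℝ} (hg : HasDerivAt g g' s)
    (hf : ContinuousAt f s) (hd : HasDerivAt (fun r => inner ℂ (g s) (f r)) d s) :
    HasDerivAt (fun r => inner ℂ (g r) (f r)) (inner ℂ g' (f s) + d) s := by
  have h1 : HasDerivAt (fun r => inner ℂ (g r - g s) (f r)) (inner ℂ g' (f s)) s := by
    rw [hasDerivAt_iff_tendsto_slope] at hg ⊢
    have h2 := hg.inner (𝕜 := ℂ) (hf.tendsto.mono_left (nhdsWithin_le_nhds (s := {s}ᶜ)))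
    refine h2.congr fun r => ?_
    simp only [slope, vsub_eq_sub, sub_self, inner_zero_left, sub_zero]
    rw [← Complex.coe_smul, inner_smul_left, Complex.conj_ofReal, ← Complex.coe_smul, smul_eq_mul]
  refine (h1.add hd).congr_of_eventuallyEq (Eventually.of_forall fun r => ?_)
  simp only [Pi.add_apply]
  rw [← inner_add_left, sub_add_cancel]

theorem norm_exp_I_mul_sub_sub_le (a : ℝ) :
    ‖Complex.exp (Complex.I * (a : ℂ)) - 1 - Complex.I * a‖ ≤ 3 * a ^ 2 := by
  have hn : ‖Complex.I * (a : ℂ)‖ = |a| := by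
    rw [norm_mul, Complex.norm_I, one_mul, Complex.norm_real, Real.norm_eq_abs]
  rcases le_total |a| 1 with h | h
  · have := Complex.norm_exp_sub_one_sub_id_le (hn.trans_le h)
    rw [hn, sq_abs] at this
    nlinarith [sq_nonneg a]
  · have h1 : ‖Complex.exp (Complex.I * (a : ℂ))‖ = 1 := by
      rw [mul_comm, Complex.norm_exp_ofReal_mul_I]
    have h2 := norm_sub_le (Complex.exp (Complex.I * (a : ℂ)) - 1) (Complex.I * a)
    have h3 := norm_sub_le (Complex.exp (Complex.I * (a : ℂ))) 1
    rw [h1, norm_one] at h3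
    rw [hn] at h2
    nlinarith [sq_abs a]

/-- The Taylor remainder of the phase is at most `3 (r - s)²` times the squared symbol, and the
squared symbol times `ψ` is still in `L²`. -/
theorem hasDerivAt_phaseMul_schwartz (α : ℝ) (ψ : 𝓢(ℝ, ℂ)) (s : ℝ) :
    HasDerivAt (fun t => phaseMul α t (ψ.toLp 2))
      (Complex.I • phaseMul α s ((symbolMul α ψ).toLp 2)) s := by
  rw [hasDerivAt_iff_isLittleO]
  have hO : (fun r => phaseMul α r (ψ.toLp 2) - phaseMul α s (ψ.toLp 2)
      - (r - s) • (Complex.I • phaseMul α s ((symbolMul α ψ).toLp 2)))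
      =O[𝓝 s] fun r => (r - s) ^ 2 := by
    refine Asymptotics.IsBigO.of_bound
      (3 * ‖(symbolMul α (symbolMul α ψ)).toLp 2 (volume : Measure ℝ)‖)
      (Eventually.of_forall fun r => ?_)
    rw [Real.norm_of_nonneg (sq_nonneg _), mul_right_comm]
    refine Lp.norm_le_mul_norm_of_ae_le_mul ?_
    filter_upwards [coeFn_phaseMul α r (ψ.toLp 2), coeFn_phaseMul α s (ψ.toLp 2),
      coeFn_phaseMul α s ((symbolMul α ψ).toLp 2), ψ.coeFn_toLp 2 (volume : Measure ℝ),
      (symbolMul α ψ).coeFn_toLp 2 (volume : Measure ℝ),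
      (symbolMul α (symbolMul α ψ)).coeFn_toLp 2 (volume : Measure ℝ),
      Lp.coeFn_sub (phaseMul α r (ψ.toLp 2) - phaseMul α s (ψ.toLp 2))
        ((r - s) • (Complex.I • phaseMul α s ((symbolMul α ψ).toLp 2))),
      Lp.coeFn_sub (phaseMul α r (ψ.toLp 2)) (phaseMul α s (ψ.toLp 2)),
      Lp.coeFn_smul (r - s) (Complex.I • phaseMul α s ((symbolMul α ψ).toLp 2)),
      Lp.coeFn_smul Complex.I (phaseMul α s ((symbolMul α ψ).toLp 2))]
      with η h1 h2 h3 h4 h5 h6 h7 h8 h9 h10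
    rw [h7, Pi.sub_apply, h8, Pi.sub_apply, h9, Pi.smul_apply, h10, Pi.smul_apply, h1, h2, h3, h4,
      h5, h6]
    simp only [symbolMul_apply]
    have hr : phase α r η = phase α s η * phase α (r - s) η := by
      rw [← phase_add, add_sub_cancel]
    have hfac : phase α r η * ψ η - phase α s η * ψ η
        - (r - s) • Complex.I • (phase α s η * ((fourthOrderSymbol α η : ℂ) * ψ η))
        = phase α s η * ((phase α (r - s) η - 1
          - Complex.I * (((r - s) * fourthOrderSymbol α η : ℝ) : ℂ)) * ψ η) := by
      rw [hr, Complex.real_smul, smul_eq_mul]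
      push_cast
      ring
    rw [hfac, norm_mul, norm_phase, one_mul, norm_mul]
    refine (mul_le_mul_of_nonneg_right (norm_exp_I_mul_sub_sub_le _) (norm_nonneg _)).trans_eq ?_
    rw [norm_mul, norm_mul, Complex.norm_real, Real.norm_eq_abs, mul_pow, ← sq_abs
      (fourthOrderSymbol α η)]
    ring
  refine hO.trans_isLittleO ?_
  have h1 : (fun r : ℝ => (r - s) ^ 2) = fun r => (r - s) * (r - s) := by
    funext r; ring
  rw [h1]
  have h2 : (fun r : ℝ => r - s) =o[𝓝 s] fun _ => (1 : ℝ) := by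
    rw [Asymptotics.isLittleO_one_iff]
    have : Continuous fun r : ℝ => r - s := by fun_prop
    simpa using this.tendsto s
  simpa using h2.mul_isBigO (Asymptotics.isBigO_refl (fun r : ℝ => r - s) (𝓝 s))

/-- The pairing of `𝓕 (V s)` with the evolved `ψ` has zero derivative, as the two contributions of
the symbol cancel. Comparing times `t` and `0` for all smooth compactly supported `ψ` identifies `𝓕
(V t)` almost everywhere. -/
theorem fourier_eq_phaseMul_of_isFourthOrderSolution {α : ℝ} {u₀ : ℝ → ℂ} {V : ℝ →ᵇ L2R}
    (hV : IsFourthOrderSolution α u₀ V) (t : ℝ) :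
    (𝓕 (V t) : L2R) = phaseMul α t (𝓕 (V 0)) := by
  have heq := (isFourthOrderSolution_iff.1 hV).2
  have hcont : Continuous fun s => (𝓕 (V s) : L2R) :=
    (Lp.fourierTransformₗᵢ ℝ ℂ).continuous.comp V.continuous
  have hinner : ∀ (s : ℝ) (ψ Θ : 𝓢(ℝ, ℂ)) (f : L2R),
      (∀ η, Θ η = phase α (-s) η * (starRingEnd ℂ) (ψ η)) →
      inner ℂ (phaseMul α s (ψ.toLp 2)) f = ∫ η, f η * Θ η := by
    intro s ψ Θ f hΘ
    rw [L2.inner_def]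
    refine integral_congr_ae ?_
    filter_upwards [coeFn_phaseMul α s (ψ.toLp 2), ψ.coeFn_toLp 2 (volume : Measure ℝ)]
      with η h1 h2
    rw [RCLike.inner_apply, h1, h2, hΘ, map_mul, conj_phase]
  have hconst : ∀ g : ℝ → ℝ, ContDiff ℝ ∞ g → HasCompactSupport g → ∃ ψ : 𝓢(ℝ, ℂ),
      (∀ η, ψ η = (g η : ℂ)) ∧ inner ℂ (phaseMul α t (ψ.toLp 2)) (𝓕 (V t) : L2R)
        = inner ℂ (phaseMul α 0 (ψ.toLp 2)) (𝓕 (V 0) : L2R) := by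
    intro g hg hgc
    have hgC : ContDiff ℝ ∞ fun η => (g η : ℂ) := Complex.ofRealCLM.contDiff.comp hg
    have hgCc : HasCompactSupport fun η => (g η : ℂ) := hgc.comp_left Complex.ofReal_zero
    let ψ : 𝓢(ℝ, ℂ) := hgCc.toSchwartzMap hgC
    have hψ : ∀ η, ψ η = (g η : ℂ) := fun η => rfl
    refine ⟨ψ, hψ, ?_⟩
    have hd : ∀ s, HasDerivAt
        (fun r => inner ℂ (phaseMul α r (ψ.toLp 2)) (𝓕 (V r) : L2R)) 0 s := by
      intro s
      -- The evolved test function, conjugated and frozen at time `s`; compact support makes it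
      -- Schwartz despite the phase.
      let Θ : 𝓢(ℝ, ℂ) := HasCompactSupport.toSchwartzMap
        (f := fun η => phase α (-s) η * (g η : ℂ)) hgCc.mul_left
        ((contDiff_phase α (-s)).mul hgC)
      have hΘ : ∀ η, Θ η = phase α (-s) η * (g η : ℂ) := fun η => rfl
      have h1 : ∀ r, inner ℂ (phaseMul α s (ψ.toLp 2)) (𝓕 (V r) : L2R)
          = ∫ η, (𝓕 (V r) : L2R) η * Θ η := fun r =>
        hinner s ψ Θ _ fun η => by rw [hΘ, hψ, Complex.conj_ofReal]
      have h2 : inner ℂ (phaseMul α s ((symbolMul α ψ).toLp 2)) (𝓕 (V s) : L2R)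
          = ∫ η, (𝓕 (V s) : L2R) η * symbolMul α Θ η :=
        hinner s _ _ _ fun η => by
          rw [symbolMul_apply, symbolMul_apply, hΘ, hψ, map_mul, Complex.conj_ofReal,
            Complex.conj_ofReal]
          ring
      have h3 := heq Θ s
      simp only [← h1] at h3
      refine (hasDerivAt_inner_of_continuousAt (hasDerivAt_phaseMul_schwartz α ψ s)
        hcont.continuousAt h3).congr_deriv ?_
      rw [inner_smul_left, Complex.conj_I, h2]
      ring
    exact is_const_of_deriv_eq_zero (fun s => (hd s).differentiableAt) (fun s => (hd s).deriv) t 0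
  have hae : ∀ᵐ η, phase α (-t) η * (𝓕 (V t) : L2R) η = (𝓕 (V 0) : L2R) η := by
    have hmem : MemLp (fun η => phase α (-t) η * (𝓕 (V t) : L2R) η) 2 volume :=
      memLp_phase_mul α (-t) _
    refine ae_eq_of_integral_contDiff_smul_eq (hmem.locallyIntegrable (by norm_num))
      ((Lp.memLp _).locallyIntegrable (by norm_num)) fun g hg hgc => ?_
    obtain ⟨ψ, hψ, h⟩ := hconst g hg hgc
    rw [phaseMul_zero, L2.inner_def, L2.inner_def] at h
    convert h using 1
    · refine integral_congr_ae ?_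
      filter_upwards [coeFn_phaseMul α t (ψ.toLp 2), ψ.coeFn_toLp 2 (volume : Measure ℝ)]
        with η h1 h2
      rw [RCLike.inner_apply, h1, h2, hψ, map_mul, conj_phase, Complex.conj_ofReal,
        Complex.real_smul]
      ring
    · refine integral_congr_ae ?_
      filter_upwards [ψ.coeFn_toLp 2 (volume : Measure ℝ)] with η h2
      rw [RCLike.inner_apply, h2, hψ, Complex.conj_ofReal, Complex.real_smul]
      ring
  refine Lp.ext ?_
  filter_upwards [hae, coeFn_phaseMul α t (𝓕 (V 0) : L2R)] with η h1 h2
  rw [h2, ← h1, ← mul_assoc, ← phase_add, add_neg_cancel, phase]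
  simp

theorem isFourthOrderSolution_unique {α : ℝ} {u₀ : ℝ → ℂ} {U V : ℝ →ᵇ L2R}
    (hU : IsFourthOrderSolution α u₀ U) (hV : IsFourthOrderSolution α u₀ V) : V = U := by
  ext1 t
  have h0 : V 0 = U 0 := Lp.ext (hV.initial.trans hU.initial.symm)
  refine (Lp.fourierTransformₗᵢ ℝ ℂ).injective ?_
  change (𝓕 (V t) : L2R) = 𝓕 (U t)
  rw [fourier_eq_phaseMul_of_isFourthOrderSolution hV, fourier_eq_phaseMul_of_isFourthOrderSolution
    hU, h0]

/-! ### The solution as an improper oscillatory integral -/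

theorem continuous_fourierInv_of_integrable {f : ℝ → ℂ} (hf : Integrable f) :
    Continuous (𝓕⁻ f) := by
  have h : Continuous (𝓕 f) := VectorFourier.fourierIntegral_continuous
    Real.continuous_fourierChar (by exact continuous_inner) hf
  have e : (𝓕⁻ f) = fun x => (𝓕 f) (-x) := funext fun x => Real.fourierInv_eq_fourier_neg f x
  rw [e]
  exact h.comp continuous_neg

/-- On `L¹ ∩ L²` the `L²` inverse Fourier transform is given by the Fourier integral. -/
theorem fourierInv_L2_ae_eq {F : L2R} {f : ℝ → ℂ} (hFf : (F : ℝ → ℂ) =ᵐ[volume] f)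
    (hf : Integrable f) : ((𝓕⁻ F : L2R) : ℝ → ℂ) =ᵐ[volume] 𝓕⁻ f := by
  refine ae_eq_of_integral_contDiff_smul_eq ((Lp.memLp _).locallyIntegrable (by norm_num))
    (continuous_fourierInv_of_integrable hf).locallyIntegrable fun g hg hgc => ?_
  have hgC : ContDiff ℝ ∞ fun η => (g η : ℂ) := Complex.ofRealCLM.contDiff.comp hg
  have hgCc : HasCompactSupport fun η => (g η : ℂ) := hgc.comp_left Complex.ofReal_zero
  let ψ : 𝓢(ℝ, ℂ) := hgCc.toSchwartzMap hgC
  have hψ : ∀ η, ψ η = (g η : ℂ) := fun η => rfl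
  have h := congrArg (fun T : 𝓢'(ℝ, ℂ) => T ψ) (Lp.fourierInv_toTemperedDistribution_eq F)
  simp only [TemperedDistribution.fourierInv_apply, Lp.toTemperedDistribution_apply] at h
  have h2 : ∫ x, (𝓕⁻ f) x • ψ x = ∫ x, f x • (𝓕⁻ (ψ : ℝ → ℂ)) x := by
    have hflip : (-innerₗ ℝ : ℝ →ₗ[ℝ] ℝ →ₗ[ℝ] ℝ).flip = -innerₗ ℝ := by
      ext
      simp
    have h3 := VectorFourier.integral_fourierIntegral_smul_eq_flip (L := -innerₗ ℝ)
      Real.continuous_fourierChar (by exact continuous_inner.neg) hf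
      (ψ.integrable (μ := volume))
    rw [hflip] at h3
    exact h3
  have h4 : ∫ x, (𝓕⁻ ψ) x • F x = ∫ x, f x • (𝓕⁻ (ψ : ℝ → ℂ)) x := by
    refine integral_congr_ae ?_
    filter_upwards [hFf] with x hx
    rw [hx, SchwartzMap.fourierInv_coe, smul_eq_mul, smul_eq_mul, mul_comm]
  refine Eq.trans ?_ ((h.symm.trans (h4.trans h2.symm)).trans ?_)
  · simp only [hψ, Complex.coe_smul]
  · refine integral_congr_ae (Eventually.of_forall fun x => ?_)
    simp only [hψ]
    rw [smul_eq_mul, mul_comm, Complex.real_smul]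

/-- The Fourier transform of `x ↦ ∫ exp (i ((x - x₀) w + τ (w⁴ + α w²))) / w dw`, the integral
being taken over those `w = 2πη` with `η ∈ S`. -/
noncomputable def oscSpectrum (α x₀ τ : ℝ) (S : Set ℝ) : ℝ → ℂ :=
  S.indicator fun η => phase α τ η * (Complex.exp (Complex.I * ((-(2 * Real.pi * x₀ * η) : ℝ) : ℂ))
    * ((η⁻¹ : ℝ) : ℂ))

theorem norm_oscSpectrum_le (α x₀ τ : ℝ) {S T : Set ℝ} (hST : S ⊆ T) (hT : ∀ η ∈ T, 0 < η)
    (η : ℝ) : ‖oscSpectrum α x₀ τ S η‖ ≤ T.indicator (fun η => η⁻¹) η := by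
  rw [oscSpectrum]
  by_cases hS : η ∈ S
  · rw [Set.indicator_of_mem hS, Set.indicator_of_mem (hST hS), norm_mul, norm_phase, one_mul,
      norm_mul, mul_comm Complex.I, Complex.norm_exp_ofReal_mul_I, one_mul, Complex.norm_real,
      Real.norm_of_nonneg (inv_nonneg.2 (hT η (hST hS)).le)]
  · rw [Set.indicator_of_notMem hS, norm_zero]
    exact Set.indicator_nonneg (fun η hη => inv_nonneg.2 (hT η hη).le) η

theorem aestronglyMeasurable_oscSpectrum (α x₀ τ : ℝ) {S : Set ℝ} (hS : MeasurableSet S) :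
    AEStronglyMeasurable (oscSpectrum α x₀ τ S) volume := by
  refine AEStronglyMeasurable.indicator ?_ hS
  refine (contDiff_phase α τ (n := 0)).continuous.aestronglyMeasurable.mul ?_
  refine AEStronglyMeasurable.mul (Continuous.aestronglyMeasurable (by fun_prop)) ?_
  exact (Complex.measurable_ofReal.comp measurable_inv).aestronglyMeasurable

theorem integrable_indicator_inv_sq {c : ℝ} (hc : 0 < c) :
    Integrable fun η => (Set.Ioi c).indicator (fun η : ℝ => η⁻¹) η ^ 2 := by
  have h := (integrableOn_Ioi_rpow_of_lt (show (-2 : ℝ) < -1 by norm_num) hc)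
  rw [← integrable_indicator_iff measurableSet_Ioi] at h
  refine h.congr (Eventually.of_forall fun η => ?_)
  by_cases hη : η ∈ Set.Ioi c
  · simp only [Set.indicator_of_mem hη]
    rw [Real.rpow_neg (hc.trans hη).le, inv_pow, Real.rpow_two]
  · simp [Set.indicator_of_notMem hη]

theorem memLp_oscSpectrum (α x₀ τ : ℝ) {S : Set ℝ} (hS : MeasurableSet S) {c : ℝ} (hc : 0 < c)
    (hSc : S ⊆ Set.Ioi c) : MemLp (oscSpectrum α x₀ τ S) 2 volume := by
  have hm := aestronglyMeasurable_oscSpectrum α x₀ τ hS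
  refine (memLp_two_iff_integrable_sq_norm hm).2 ?_
  refine (integrable_indicator_inv_sq hc).mono' (hm.norm.pow 2) (Eventually.of_forall fun η => ?_)
  rw [Real.norm_of_nonneg (by positivity)]
  exact pow_le_pow_left₀ (norm_nonneg _)
    (norm_oscSpectrum_le α x₀ τ hSc (fun η hη => hc.trans hη) η) 2

theorem integrable_oscSpectrum (α x₀ τ : ℝ) {c d : ℝ} (hc : 0 < c) :
    Integrable (oscSpectrum α x₀ τ (Set.Ioc c d)) := by
  refine (integrable_indicator_iff measurableSet_Ioc).2 ?_
  refine (ContinuousOn.integrableOn_Icc ?_).mono_set Set.Ioc_subset_Icc_self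
  refine (contDiff_phase α τ (n := 0)).continuous.continuousOn.mul
    (ContinuousOn.mul (by fun_prop) ?_)
  exact Complex.continuous_ofReal.comp_continuousOn
    (continuousOn_inv₀.mono fun _ hw => (hc.trans_le hw.1).ne')

theorem fourierInv_oscSpectrum (α x₀ τ x : ℝ) {B : ℝ} (hB : 1 ≤ B) :
    (𝓕⁻ (oscSpectrum α x₀ τ (Set.Ioc (1 / (2 * Real.pi)) (B / (2 * Real.pi))))) x
      = oscIntegral α 1 B (x - x₀) τ := by
  have hpi : 0 < 2 * Real.pi := by positivity
  set G : ℝ → ℂ := fun w => Complex.exp (Complex.I *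
    (((x - x₀) * w + τ * (w ^ 4 + α * w ^ 2) : ℝ) : ℂ)) * ((w⁻¹ : ℝ) : ℂ) with hG
  have h1 : oscIntegral α 1 B (x - x₀) τ
      = ∫ η in (1 / (2 * Real.pi))..(B / (2 * Real.pi)), (2 * Real.pi : ℝ) • G (2 * Real.pi * η) := by
    rw [intervalIntegral.integral_smul, intervalIntegral.smul_integral_comp_mul_left,
      mul_div_cancel₀ _ hpi.ne', mul_div_cancel₀ _ hpi.ne', oscIntegral]
  rw [h1, intervalIntegral.integral_of_le (div_le_div_of_nonneg_right hB hpi.le),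
    ← integral_indicator measurableSet_Ioc, Real.fourierInv_eq']
  refine integral_congr_ae (Eventually.of_forall fun η => ?_)
  simp only [oscSpectrum]
  by_cases hη : η ∈ Set.Ioc (1 / (2 * Real.pi)) (B / (2 * Real.pi))
  · rw [Set.indicator_of_mem hη, Set.indicator_of_mem hη, hG]
    simp only [phase, fourthOrderSymbol]
    rw [smul_eq_mul, Complex.real_smul, ← mul_assoc (Complex.exp _) (Complex.exp _),
      ← Complex.exp_add, ← mul_assoc, ← Complex.exp_add, mul_left_comm, ← Complex.ofReal_mul,
      mul_inv, mul_inv_cancel_left₀ hpi.ne']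
    congr 2
    simp only [RCLike.inner_apply, conj_trivial]
    push_cast
    ring
  · rw [Set.indicator_of_notMem hη, Set.indicator_of_notMem hη, smul_zero]

/-- The full spectrum need not be integrable, so it is cut off. The cut-off transforms are
`oscIntegral`; they converge in `L²`, hence almost everywhere along a subsequence, and pointwise to
`oscLimit` for `x ≠ x₀`. Discarding that one point covers `τ = 0` as well. -/
theorem fourierInv_oscSpectrum_ae_eq {α x₀ τ : ℝ} (hα : |α| ≤ 1) {F : L2R}
    (hF : (F : ℝ → ℂ) =ᵐ[volume] oscSpectrum α x₀ τ (Set.Ioi (1 / (2 * Real.pi)))) :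
    (fun x : ℝ => oscLimit α (x - x₀) τ) =ᵐ[volume] ((𝓕⁻ F : L2R) : ℝ → ℂ) := by
  have hpi : 0 < 2 * Real.pi := by positivity
  have hc : 0 < 1 / (2 * Real.pi) := by positivity
  set S : ℕ → Set ℝ := fun n => Set.Ioc (1 / (2 * Real.pi)) (((n : ℝ) + 1) / (2 * Real.pi))
    with hS
  have hSc : ∀ n, S n ⊆ Set.Ioi (1 / (2 * Real.pi)) := fun n => Set.Ioc_subset_Ioi_self
  have hmem : ∀ n, MemLp (oscSpectrum α x₀ τ (S n)) 2 volume := fun n =>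
    memLp_oscSpectrum α x₀ τ measurableSet_Ioc hc (hSc n)
  have hlim : Tendsto (fun n => (hmem n).toLp) atTop (𝓝 F) := by
    refine tendsto_L2_of_dominated (fun n => (hmem n).coeFn_toLp) hF
      (integrable_indicator_inv_sq hc)
      (fun n => Eventually.of_forall
        (norm_oscSpectrum_le α x₀ τ (hSc n) fun η hη => hc.trans hη))
      (Eventually.of_forall
        (norm_oscSpectrum_le α x₀ τ subset_rfl fun η hη => hc.trans hη))
      (Eventually.of_forall fun η => ?_)
    refine tendsto_const_nhds.congr' ?_
    filter_upwards [eventually_ge_atTop ⌈η * (2 * Real.pi)⌉₊] with n hn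
    have hn' : η ≤ ((n : ℝ) + 1) / (2 * Real.pi) := by
      rw [le_div_iff₀ hpi]
      exact (Nat.ceil_le.1 hn).trans (by linarith)
    simp only [oscSpectrum, Set.indicator, hS, Set.mem_Ioi, Set.mem_Ioc, hn', and_true]
  have hlim' : Tendsto (fun n => (𝓕⁻ (hmem n).toLp : L2R)) atTop (𝓝 (𝓕⁻ F)) :=
    ((Lp.fourierTransformₗᵢ ℝ ℂ).symm.continuous.tendsto F).comp hlim
  obtain ⟨ns, hns, hae⟩ := (tendstoInMeasure_of_tendsto_Lp hlim').exists_seq_tendsto_ae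
  have heq : ∀ᵐ x : ℝ, ∀ n, (𝓕⁻ (hmem n).toLp : L2R) x
      = oscIntegral α 1 ((n : ℝ) + 1) (x - x₀) τ := by
    refine ae_all_iff.2 fun n => ?_
    filter_upwards [fourierInv_L2_ae_eq (hmem n).coeFn_toLp (integrable_oscSpectrum α x₀ τ hc)]
      with x hx
    rw [hx, fourierInv_oscSpectrum α x₀ τ x (by simp)]
  filter_upwards [hae, heq, Measure.ae_ne volume x₀] with x h1 h2 h3
  simp only [h2] at h1
  have h4 : Tendsto (fun i => ((ns i : ℕ) : ℝ) + 1) atTop atTop :=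
    tendsto_atTop_add_const_right _ _ (tendsto_natCast_atTop_atTop.comp hns.tendsto_atTop)
  exact tendsto_nhds_unique
    ((tendsto_oscIntegral hα (Or.inl (sub_ne_zero.2 h3))).comp h4) h1

theorem phaseMul_oscSpectrum_ae_eq (α x₀ τ t : ℝ) {S : Set ℝ} {F : L2R}
    (hF : (F : ℝ → ℂ) =ᵐ[volume] oscSpectrum α x₀ τ S) :
    (phaseMul α t F : ℝ → ℂ) =ᵐ[volume] oscSpectrum α x₀ (t + τ) S := by
  filter_upwards [coeFn_phaseMul α t F, hF] with η h1 h2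
  rw [h1, h2, oscSpectrum, oscSpectrum]
  by_cases hη : η ∈ S
  · rw [Set.indicator_of_mem hη, Set.indicator_of_mem hη, ← mul_assoc, ← phase_add]
  · rw [Set.indicator_of_notMem hη, Set.indicator_of_notMem hη, mul_zero]

theorem exists_flow_ae_eq_oscLimit {α : ℝ} (hα : |α| ≤ 1) (x₀ t₀ : ℝ) :
    ∃ F : L2R, ∀ t : ℝ, (fun x : ℝ => oscLimit α (x - x₀) (t - t₀)) =ᵐ[volume]
      (fourthOrderFlow α F t : ℝ → ℂ) := by
  have hmem : MemLp (oscSpectrum α x₀ (-t₀) (Set.Ioi (1 / (2 * Real.pi)))) 2 volume :=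
    memLp_oscSpectrum α x₀ (-t₀) measurableSet_Ioi (by positivity) subset_rfl
  obtain ⟨F, hF⟩ : ∃ F : L2R, (F : ℝ → ℂ) =ᵐ[volume]
      oscSpectrum α x₀ (-t₀) (Set.Ioi (1 / (2 * Real.pi))) := ⟨hmem.toLp, hmem.coeFn_toLp⟩
  refine ⟨F, fun t => ?_⟩
  rw [fourthOrderFlow_apply, sub_eq_add_neg t t₀]
  exact fourierInv_oscSpectrum_ae_eq hα (phaseMul_oscSpectrum_ae_eq α x₀ (-t₀) t hF)

theorem mainTheorem10 (α : ℝ) (hα : α ∈ ({0, -1, 1} : Set ℝ))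
    (x₀ t₀ : ℝ) (ht₀ : t₀ ≠ 0) :
    ∃ u₀ : ℝ → ℂ,
      ContDiff ℝ ∞ u₀ ∧ MemLp u₀ 2 volume ∧ MemLp u₀ ⊤ volume ∧
      ∃ U : ℝ →ᵇ L2R,
        IsFourthOrderSolution α u₀ U ∧
        (∀ V : ℝ →ᵇ L2R, IsFourthOrderSolution α u₀ V → V = U) ∧
        ∃ u : ℝ × ℝ → ℂ,
          (∀ t : ℝ, (fun x : ℝ => u (x, t)) =ᵐ[volume] (U t : ℝ → ℂ)) ∧
          Tendsto (fun z : ℝ × ℝ => ‖u z‖) (𝓝[≠] (x₀, t₀)) atTop ∧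
          ContinuousOn u {z : ℝ × ℝ | z.2 ≠ t₀} ∧
          ContinuousOn (fun x : ℝ => u (x, t₀)) {x : ℝ | x ≠ x₀} := by
  have hα1 : |α| ≤ 1 := by
    rcases hα with rfl | rfl | rfl <;> simp
  -- The initial time is not the singular time, so the initial datum is smooth and bounded.
  have hτ : (0 : ℝ) - t₀ ≠ 0 := by simpa using ht₀
  obtain ⟨F, hF⟩ := exists_flow_ae_eq_oscLimit hα1 x₀ t₀
  have hsmooth : ContDiff ℝ ∞ fun x => oscLimit α (x - x₀) (0 - t₀) :=
    (contDiff_oscLimit hα1 hτ).comp (contDiff_id.sub contDiff_const)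
  have hsol : IsFourthOrderSolution α (fun x => oscLimit α (x - x₀) (0 - t₀))
      (fourthOrderFlow α F) := isFourthOrderSolution_flow α F (hF 0).symm
  refine ⟨fun x => oscLimit α (x - x₀) (0 - t₀), hsmooth,
    (memLp_congr_ae (hF 0)).2 (Lp.memLp _), ?_, fourthOrderFlow α F, hsol,
    fun V hV => isFourthOrderSolution_unique hsol hV,
    fun z => oscLimit α (z.1 - x₀) (z.2 - t₀), hF, ?_, fun z hz => ?_, fun x hx => ?_⟩
  · exact memLp_top_of_bound hsmooth.continuous.aestronglyMeasurable _
      (Eventually.of_forall fun x => norm_oscLimit_le hα1 hτ)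
  · have hshift : Tendsto (fun z : ℝ × ℝ => (z.1 - x₀, z.2 - t₀)) (𝓝[≠] (x₀, t₀))
        (𝓝[≠] (0, 0)) := by
      refine tendsto_nhdsWithin_iff.2 ⟨?_, ?_⟩
      · have h : Continuous fun z : ℝ × ℝ => (z.1 - x₀, z.2 - t₀) := by fun_prop
        simpa using (h.tendsto (x₀, t₀)).mono_left nhdsWithin_le_nhds
      · filter_upwards [self_mem_nhdsWithin] with z hz h0
        obtain ⟨h1, h2⟩ := Prod.mk.inj h0
        exact hz (Prod.ext (sub_eq_zero.1 h1) (sub_eq_zero.1 h2))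
    have h := (tendsto_norm_oscLimit_atTop hα1).comp hshift
    exact h
  · refine ContinuousAt.continuousWithinAt ?_
    exact ContinuousAt.comp (f := fun z : ℝ × ℝ => (z.1 - x₀, z.2 - t₀))
      (continuousAt_oscLimit hα1 (sub_ne_zero.2 hz)) (by fun_prop)
  · refine ContinuousAt.continuousWithinAt ?_
    simp only [sub_self]
    exact ContinuousAt.comp (f := fun x : ℝ => x - x₀)
      (continuousAt_oscLimit_zero hα1 (sub_ne_zero.2 hx)) (by fun_prop)
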